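/- **Definitions.** Let $k\ge 0$ and $n,n'\ge 1$ be integers and $N=n^2n'$. A sequence $e_1,\dots,e_T$ of edges has *node locality* $k$ if for every node $v$ the positions of the last and of the first edge containing $v$ differ by at most $k$. A *$k$-local $(n,n')$-factored graph* is a simple undirected graph $G=(V,E)$ with $|E|=N$ and an enumeration $e_1,\dots,e_N$ of $E$ for which there are a kernel graph $G_*=(V_*,E_*)$ with $V_*\subseteq V$, $|V_*|=n$, and, for every ordered pair $(v_1,v_2)\in V_*^2$, a super-edge graph $G_{v_1,v_2}=(\{v_1,v_2\}\cup V_{v_1,v_2},E_{v_1,v_2})$ with $|E_{v_1,v_2}|=n'$, such that 1. $V$ is the disjoint union of $V_*$ and all $V_{v_1,v_2}$, and $E$ is the disjoint union of all $E_{v_1,v_2}$; 2. if $v_1=v_2$ or $\{v_1,v_2\}\in E_*$, then $G_{v_1,v_2}$ is connected; otherwise $G_{v_1,v_2}$ has exactly two connected components, one containing $v_1$ and the other containing $v_2$; 3. $e_1,\dots,e_N$ is the concatenation, in some (arbitrary) order of the pairs $(v_1,v_2)\in V_*^2$, of enumerations of the sets $E_{v_1,v_2}$, each of node locality $k$. The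 nodes of $G$ are labelled $0,\dots,|V|-1$ in an arbitrary way, and the input is the sequence of tokens $P_{e_i}=(u,w)$, where $e_i=\{u,w\}$ with $u<w$. *Models.* All numbers passed between operations are fixed-point numbers $z/2^p$ with $z\in\mathbb Z$, $|z|\le 4^p$; real results are rounded to the nearest such number, saturating at the ends of the range. A *hybrid model* with precision $p$, hidden dimension $h$, embedding dimension $m$, depth $L$ and $H$ heads consists of * one RNN layer $(y_i,h_i)=g(P_{e_i},h_{i-1})$ with $h_i$ of dimension $h$, $y_i$ of dimension $m$, and a fixed initial state $h_0$; * $L$ Transformer layers $X\mapsto X'$, $X'_i=\mathrm{MLP}\bigl(X_i+\sum_{a=1}^{H}\sum_j \mathrm{softmax}_j\bigl(\langle Q_a(X_i),K_a(X_j)\rangle\bigr)\,V_a(X_j)\bigr)$, where the attention is non-causal over all $N$ tokens and inner products, softmax weights, head outputs and residual sums are rounded; * a readout of the vector at the last position to $\{0,1\}$. Here $g$, $Q_a$, $K_a$, $V_a$, $\mathrm{MLP}$ and the readout are arbitrary functions on fixed-point vectors of these dimensions, the same at all positions. The model *solves connectivity* on a class of graphs if on the token sequence of every graph of the class its output is $1$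 if the graph is connected and $0$ if not. **Theorem.** There is an absolute constant $C_1$, and for every $\epsilon\in(0,1)$ a constant $C_2=C_2(\epsilon)$, such that for all integers $k\ge0$ and $n,n'\ge1$ there is a hybrid model that solves connectivity on all $k$-local $(n,n')$-factored graphs (with every labelling of the nodes and every order of the super-edge graphs) and that has * a single RNN layer, of hidden dimension at most $C_1(k+1)$, * at most $C_2\log n$ Transformer layers, of embedding dimension at most $C_2n^\epsilon$ and with at most $C_2$ heads each, * precision $p\le C_2\log(n^2n'+1)$. In particular, apart from the bit precision, the size of the model does not depend on $n'$. -/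

import Mathlib

open scoped BigOperators

/-! ## Graphs given as sequences of edges -/

/-- A sequence of edges has node locality at most `k`: for every node, the last and the first
position of an edge adjoining that node differ by at most `k`. -/
def HasNodeLocality {V : Type*} {T : ℕ} (k : ℕ) (e : Fin T → Sym2 V) : Prop :=
  ∀ (v : V) (i j : Fin T), v ∈ e i → v ∈ e j → (j : ℕ) - (i : ℕ) ≤ k

/-- The `j`-th of the consecutive blocks of length `n'` of a sequence of length `b * n'`:
its `r`-th entry is the entry of the whole sequence at position `j * n' + r`. -/
def edgeBlock {α : Type*} {b n' : ℕ} (e : Fin (b * n') → α) (j : Fin b) : Fin n' → α :=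
  fun r => e (finProdFinEquiv (j, r))

/-- The graph `G`, presented by the sequence `e` of its `n ^ 2 * n'` edges, is a
`k`-local `(n, n')`-factored graph. -/
structure FactoredGraph (k n n' : ℕ) {V : Type*} (G : SimpleGraph V)
    (e : Fin (n ^ 2 * n') → Sym2 V) where
  /-- the `n` super-nodes, as nodes of `G` -/
  superNode : Fin n ↪ V
  /-- the kernel graph on the super-nodes -/
  kernel : SimpleGraph (Fin n)
  /-- the inner nodes of the super-edge graph of an ordered pair of super-nodes -/
  inner : Fin n × Fin n → Set V
  /-- the super-edge graph of an ordered pair of super-nodes -/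
  super : Fin n × Fin n → G.Subgraph
  /-- the order in which the super-edge graphs are listed -/
  order : Fin (n ^ 2) ≃ Fin n × Fin n
  super_verts : ∀ q, (super q).verts = {superNode q.1, superNode q.2} ∪ inner q
  superNode_notMem_inner : ∀ a q, superNode a ∉ inner q
  inner_disjoint : ∀ q q', q ≠ q' → Disjoint (inner q) (inner q')
  verts_cover : Set.range superNode ∪ ⋃ q, inner q = Set.univ
  edges_disjoint : ∀ q q', q ≠ q' → Disjoint (super q).edgeSet (super q').edgeSet
  edges_cover : ⋃ q, (super q).edgeSet = G.edgeSet
  /-- A super-edge graph of a kernel edge is connected. For a pair `(v, v)` the two end points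
  coincide and cannot lie in different components, so these super-edge graphs are connected too. -/
  connected : ∀ q, (q.1 = q.2 ∨ kernel.Adj q.1 q.2) → (super q).coe.Connected
  /-- Otherwise it has two components, one with each of the end points. -/
  two_components : ∀ q, ¬ (q.1 = q.2 ∨ kernel.Adj q.1 q.2) →
    Nat.card (super q).coe.ConnectedComponent = 2 ∧
    ∀ x y : (super q).verts, (x : V) = superNode q.1 → (y : V) = superNode q.2 →
      ¬ (super q).coe.Reachable x y
  /-- The `j`-th block of the sequence lists the `n'` edges of the `j`-th super-edge graph,
  each exactly once. -/
  block_injective : ∀ j, Function.Injective (edgeBlock e j)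
  block_range : ∀ j, Set.range (edgeBlock e j) = (super (order j)).edgeSet
  block_local : ∀ j, HasNodeLocality k (edgeBlock e j)

/-! ## Finite precision arithmetic -/

/-- Signed fixed-point numbers with `p` bits before and `p` bits after the binary point;
the integer `z` stands for the real number `z / 2 ^ p`. -/
abbrev Fixed (p : ℕ) : Type := Set.Icc (-(4 ^ p) : ℤ) (4 ^ p)

/-- The real number that a fixed-point number stands for. -/
noncomputable def Fixed.toReal {p : ℕ} (x : Fixed p) : ℝ := ((x : ℤ) : ℝ) / 2 ^ p

/-- Rounding to the nearest fixed-point number, saturating at the two ends of the range. -/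
noncomputable def Fixed.ofReal (p : ℕ) (x : ℝ) : Fixed p :=
  Set.projIcc (-(4 ^ p) : ℤ) (4 ^ p)
    (neg_le_self (pow_nonneg (by norm_num) p)) (round (x * 2 ^ p))

/-- Vectors of dimension `d` with fixed-point entries. -/
abbrev FVec (p d : ℕ) : Type := Fin d → Fixed p

/-! ## Recurrent layers, transformer layers, hybrid models -/

/-- A recurrent layer with inputs of dimension `d`, hidden dimension `h` and outputs of
dimension `m`. The same transition is applied at every position. -/
structure RNNLayer (p d h m : ℕ) where
  init : FVec p h
  step : FVec p d → FVec p h → FVec p m × FVec p h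

/-- The hidden state after the first `t` tokens have been read. -/
def RNNLayer.hidden {p d h m N : ℕ} (R : RNNLayer p d h m) (X : Fin N → FVec p d) : ℕ → FVec p h
  | 0 => R.init
  | t + 1 => if ht : t < N then (R.step (X ⟨t, ht⟩) (R.hidden X t)).2 else R.hidden X t

/-- The output sequence of a recurrent layer. -/
def RNNLayer.apply {p d h m N : ℕ} (R : RNNLayer p d h m) (X : Fin N → FVec p d) :
    Fin N → FVec p m :=
  fun i => (R.step (X i) (R.hidden X i)).1

/-- A self-attention head: query, key and value embeddings, applied to each token separately. -/
structure AttentionHead (p m : ℕ) where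
  query : FVec p m → FVec p m
  key : FVec p m → FVec p m
  value : FVec p m → FVec p m

/-- The attention score (inner product of query `i` and key `j`). -/
noncomputable def AttentionHead.score {p m N : ℕ} (A : AttentionHead p m) (X : Fin N → FVec p m)
    (i j : Fin N) : Fixed p :=
  Fixed.ofReal p (∑ c, (A.query (X i) c).toReal * (A.key (X j) c).toReal)

/-- The attention weight (softmax of the scores of query `i`). -/
noncomputable def AttentionHead.weight {p m N : ℕ} (A : AttentionHead p m) (X : Fin N → FVec p m)
    (i j : Fin N) : Fixed p :=
  Fixed.ofReal p
    (Real.exp (A.score X i j).toReal / ∑ l, Real.exp (A.score X i l).toReal)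

/-- The output of the head: at each position, the weighted sum of the values. -/
noncomputable def AttentionHead.apply {p m N : ℕ} (A : AttentionHead p m)
    (X : Fin N → FVec p m) : Fin N → FVec p m :=
  fun i c => Fixed.ofReal p (∑ j, (A.weight X i j).toReal * (A.value (X j) c).toReal)

/-- A transformer layer with embedding dimension `m` and `H` heads: non-causal multi-head softmax
self-attention with a residual connection, followed by a map applied to each token separately. -/
structure TransformerLayer (p m H : ℕ) where
  head : Fin H → AttentionHead p m
  mlp : FVec p m → FVec p m

/-- The output sequence of a transformer layer. -/
noncomputable def TransformerLayer.apply {p m H N : ℕ} (A : TransformerLayer p m H)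
    (X : Fin N → FVec p m) : Fin N → FVec p m :=
  fun i => A.mlp fun c =>
    Fixed.ofReal p ((X i c).toReal + ∑ a, ((A.head a).apply X i c).toReal)

/-- A hybrid model: one recurrent layer of hidden dimension `h`, then the transformer layers
of embedding dimension `m` in the list, then a binary readout. -/
structure HybridModel (p d h m H : ℕ) where
  rnn : RNNLayer p d h m
  layers : List (TransformerLayer p m H)
  readout : FVec p m → Bool

/-- The outputs of a hybrid model at all positions. -/
noncomputable def HybridModel.run {p d h m H N : ℕ} (T : HybridModel p d h m H)
    (X : Fin N → FVec p d) : Fin N → Bool :=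
  fun i => T.readout (T.layers.foldl (fun Y A => A.apply Y) (T.rnn.apply X) i)

/-- The token of an edge between nodes in `{0, …, M - 1}`: the two end points, smaller first. -/
noncomputable def edgeToken (p : ℕ) {M : ℕ} (s : Sym2 (Fin M)) : FVec p 2 :=
  ![Fixed.ofReal p ((s.inf : Fin M) : ℕ), Fixed.ofReal p ((s.sup : Fin M) : ℕ)]

/-- The model decides connectivity of all `k`-local `(n, n')`-factored graphs with node set
`{0, …, M - 1}`, for all `M`: on the edge tokens of such a graph, its output at the last
position is `true` if the graph is connected and `false` if not. -/
def HybridModel.SolvesConnectivity {p h m H : ℕ} (T : HybridModel p 2 h m H)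
    (k n n' : ℕ) : Prop :=
  ∀ (M : ℕ) (G : SimpleGraph (Fin M)) (e : Fin (n ^ 2 * n') → Sym2 (Fin M)),
    FactoredGraph k n n' G e →
    ∀ i : Fin (n ^ 2 * n'), (i : ℕ) + 1 = n ^ 2 * n' →
      (T.run (fun t => edgeToken p (e t)) i = true ↔ G.Connected)

/-! ## Fixed-point numbers -/

/-- The fixed-point number with a given numerator, saturating at the ends of the range. -/
def Fixed.clamp (p : ℕ) (z : ℤ) : Fixed p :=
  Set.projIcc (-(4 ^ p) : ℤ) (4 ^ p) (neg_le_self (pow_nonneg (by norm_num) p)) z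

lemma Fixed.coe_clamp {p : ℕ} {z : ℤ} (h : |z| ≤ 4 ^ p) : (Fixed.clamp p z : ℤ) = z := by
  have h' := abs_le.mp h
  unfold Fixed.clamp
  rw [Set.projIcc_of_mem _ (Set.mem_Icc.mpr h')]

lemma Fixed.clamp_coe {p : ℕ} (x : Fixed p) : Fixed.clamp p (x : ℤ) = x :=
  Set.projIcc_val _ x

lemma Fixed.ofReal_eq_clamp (p : ℕ) (x : ℝ) : Fixed.ofReal p x = Fixed.clamp p (round (x * 2 ^ p)) :=
  rfl

lemma Fixed.ofReal_div (p : ℕ) (z : ℤ) : Fixed.ofReal p ((z : ℝ) / 2 ^ p) = Fixed.clamp p z := by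
  rw [Fixed.ofReal_eq_clamp, div_mul_cancel₀ _ (by positivity), round_intCast]

lemma Fixed.ofReal_toReal {p : ℕ} (x : Fixed p) : Fixed.ofReal p x.toReal = x := by
  rw [Fixed.toReal, Fixed.ofReal_div, Fixed.clamp_coe]

lemma Fixed.ofReal_intCast (p : ℕ) (z : ℤ) :
    Fixed.ofReal p (z : ℝ) = Fixed.clamp p (z * 2 ^ p) := by
  rw [Fixed.ofReal_eq_clamp]
  congr 1
  exact_mod_cast round_intCast (z * 2 ^ p)

lemma Fixed.abs_mul_two_pow_le {p : ℕ} {z : ℤ} (h : |z| ≤ 2 ^ p) : |z * 2 ^ p| ≤ 4 ^ p := by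
  rw [abs_mul, abs_of_nonneg (by positivity : (0 : ℤ) ≤ 2 ^ p)]
  calc |z| * 2 ^ p ≤ 2 ^ p * 2 ^ p := by gcongr
    _ = 4 ^ p := by rw [← mul_pow]; norm_num

lemma Fixed.toReal_clamp_mul {p : ℕ} {z : ℤ} (h : |z| ≤ 2 ^ p) :
    (Fixed.clamp p (z * 2 ^ p)).toReal = z := by
  rw [Fixed.toReal, Fixed.coe_clamp (Fixed.abs_mul_two_pow_le h)]
  push_cast
  field_simp

lemma Fixed.toReal_ofReal_intCast {p : ℕ} {z : ℤ} (h : |z| ≤ 2 ^ p) :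
    (Fixed.ofReal p (z : ℝ)).toReal = z := by
  rw [Fixed.ofReal_intCast, Fixed.toReal_clamp_mul h]

lemma Fixed.toReal_clamp_zero (p : ℕ) : (Fixed.clamp p 0).toReal = 0 := by
  rw [Fixed.toReal, Fixed.coe_clamp (by simp)]; simp

/-! ## Softmax with a dominating score -/

lemma exp_neg_le_inv_four_pow (p : ℕ) : Real.exp (-(2 * p + 2 : ℝ)) ≤ 1 / 4 ^ (p + 1) := by
  have h : Real.exp (-(2 * p + 2 : ℝ)) = (Real.exp (-2)) ^ (p + 1) := by
    rw [← Real.exp_nat_mul]; congr 1; push_cast; ring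
  rw [h, ← one_div_pow]
  gcongr
  rw [Real.exp_neg, ← one_div]
  apply one_div_le_one_div_of_le (by norm_num)
  have := Real.add_one_le_exp (1 : ℝ)
  have h2 : Real.exp 2 = Real.exp 1 * Real.exp 1 := by rw [← Real.exp_add]; norm_num
  nlinarith

/-- The gap makes every other weight at most `1 / 4 ^ (p + 1)`, which rounds to zero on a grid of
step `1 / 2 ^ p`. Fewer than `2 ^ p` such weights together take at most a quarter of a step from the
dominating weight, which therefore rounds to one. -/
lemma softmax_of_gap {p N : ℕ} (hN : N ≤ 2 ^ p) (s : Fin N → ℝ) (j₀ : Fin N)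
    (hs : ∀ j, j ≠ j₀ → s j + (2 * p + 2) ≤ s j₀) (j : Fin N) :
    (Fixed.ofReal p (Real.exp (s j) / ∑ l, Real.exp (s l))).toReal = if j = j₀ then 1 else 0 := by
  set Z := ∑ l, Real.exp (s l) with hZ
  have hZ0 : Real.exp (s j₀) ≤ Z :=
    Finset.single_le_sum (f := fun l => Real.exp (s l)) (fun _ _ => (Real.exp_pos _).le)
      (Finset.mem_univ j₀)
  have hZpos : 0 < Z := (Real.exp_pos _).trans_le hZ0
  have hsmall : ∀ j, j ≠ j₀ → Real.exp (s j) / Z ≤ 1 / 4 ^ (p + 1) := by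
    intro j hj
    calc Real.exp (s j) / Z ≤ Real.exp (s j) / Real.exp (s j₀) := by gcongr
      _ = Real.exp (s j - s j₀) := by rw [Real.exp_sub]
      _ ≤ Real.exp (-(2 * p + 2 : ℝ)) := by
          apply Real.exp_le_exp.mpr; linarith [hs j hj]
      _ ≤ _ := exp_neg_le_inv_four_pow p
  have h4 : (4 : ℝ) ^ p = 2 ^ p * 2 ^ p := by rw [← mul_pow]; norm_num
  have h2p : (0 : ℝ) < 2 ^ p := by positivity
  split_ifs with hj
  · subst hj
    have hsum : Real.exp (s j) / Z = 1 - ∑ l ∈ Finset.univ.erase j, Real.exp (s l) / Z := by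
      rw [eq_sub_iff_add_eq, Finset.add_sum_erase _ (fun l => Real.exp (s l) / Z)
        (Finset.mem_univ j), ← Finset.sum_div, div_self hZpos.ne']
    set δ := ∑ l ∈ Finset.univ.erase j, Real.exp (s l) / Z with hδ
    have hδ0 : 0 ≤ δ := Finset.sum_nonneg fun l _ => by positivity
    have hδ1 : δ ≤ 2 ^ p * (1 / 4 ^ (p + 1)) := by
      calc δ ≤ ∑ l ∈ Finset.univ.erase j, (1 / 4 ^ (p + 1) : ℝ) :=
            Finset.sum_le_sum fun l hl => hsmall l (Finset.ne_of_mem_erase hl)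
        _ = ((Finset.univ.erase j).card : ℝ) * (1 / 4 ^ (p + 1)) := by simp
        _ ≤ 2 ^ p * (1 / 4 ^ (p + 1)) := by
            gcongr
            have : (Finset.univ.erase j).card ≤ 2 ^ p :=
              (Finset.card_le_univ _).trans (by simpa using hN)
            exact_mod_cast this
    have hr : round (Real.exp (s j) / Z * 2 ^ p) = 2 ^ p := by
      rw [hsum]
      have : (1 - δ) * 2 ^ p = -(δ * 2 ^ p) + ((2 ^ p : ℤ) : ℝ) := by push_cast; ring
      rw [this, round_add_intCast]
      have h0 : round (-(δ * 2 ^ p)) = 0 := by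
        rw [round_eq_zero_iff]
        have : δ * 2 ^ p ≤ 1 / 4 := by
          calc δ * 2 ^ p ≤ (2 ^ p * (1 / 4 ^ (p + 1))) * 2 ^ p := by gcongr
            _ = 1 / 4 := by rw [pow_succ, h4]; field_simp
        constructor
        · linarith
        · have : 0 ≤ δ * 2 ^ p := by positivity
          linarith
      rw [h0, zero_add]
    rw [Fixed.ofReal_eq_clamp, hr]
    have := Fixed.toReal_clamp_mul (p := p) (z := 1) (by simp [one_le_pow₀])
    simpa using this
  · have hr : round (Real.exp (s j) / Z * 2 ^ p) = 0 := by
      rw [round_eq_zero_iff]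
      have h1 : Real.exp (s j) / Z * 2 ^ p ≤ 1 / 4 := by
        calc Real.exp (s j) / Z * 2 ^ p ≤ 1 / 4 ^ (p + 1) * 2 ^ p := by
              exact mul_le_mul_of_nonneg_right (hsmall j hj) h2p.le
          _ ≤ 1 / 4 := by
              rw [pow_succ, h4]
              have : (1 : ℝ) ≤ 2 ^ p := one_le_pow₀ (by norm_num)
              rw [div_mul_eq_mul_div, div_le_div_iff₀ (by positivity) (by norm_num)]
              nlinarith
      have h0 : 0 ≤ Real.exp (s j) / Z * 2 ^ p := by positivity
      constructor <;> linarith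
    rw [Fixed.ofReal_eq_clamp, hr, Fixed.toReal_clamp_zero]

lemma AttentionHead.apply_of_gap {p m N : ℕ} (hN : N ≤ 2 ^ p) (A : AttentionHead p m)
    (X : Fin N → FVec p m) (i j₀ : Fin N)
    (hs : ∀ j, j ≠ j₀ → (A.score X i j).toReal + (2 * p + 2) ≤ (A.score X i j₀).toReal) :
    A.apply X i = A.value (X j₀) := by
  funext c
  have hw : ∀ j, (A.weight X i j).toReal = if j = j₀ then 1 else 0 := fun j =>
    softmax_of_gap hN (fun j => (A.score X i j).toReal) j₀ hs j
  simp only [AttentionHead.apply, hw, ite_mul, one_mul, zero_mul, Finset.sum_ite_eq',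
    Finset.mem_univ, if_true, Fixed.ofReal_toReal]

lemma AttentionHead.score_eq_intCast {p m N : ℕ} {A : AttentionHead p m} {X : Fin N → FVec p m}
    {i j : Fin N} {q k : Fin m → ℤ} (hq : ∀ c, (A.query (X i) c).toReal = q c)
    (hk : ∀ c, (A.key (X j) c).toReal = k c) (hb : |∑ c, q c * k c| ≤ 2 ^ p) :
    (A.score X i j).toReal = ((∑ c, q c * k c : ℤ) : ℝ) := by
  rw [AttentionHead.score, ← Fixed.toReal_ofReal_intCast hb]
  simp [hq, hk]

/-! ## Layers that read one token -/

/-- Integer states of tokens. -/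
abbrev Tok : Type := Fin 6 → ℤ

/-- A token state as a vector, in the first six coordinates. -/
def Tok.enc (p m : ℕ) (x : Tok) : FVec p m :=
  fun c => if h : (c : ℕ) < 6 then Fixed.clamp p (x ⟨c, h⟩) else Fixed.clamp p 0

/-- The numerator of the coordinate at a given place, zero beyond the end. -/
def FVec.num {p m : ℕ} (y : FVec p m) (c : ℕ) : ℤ :=
  if h : c < m then (y ⟨c, h⟩ : ℤ) else 0

/-- The state of a token, read off its vector. -/
def Tok.dec {p m : ℕ} (y : FVec p m) : Tok := fun c => y.num c

lemma Tok.dec_enc {p m : ℕ} (hm : 6 ≤ m) {x : Tok} (hx : ∀ c, |x c| ≤ 4 ^ p) :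
    Tok.dec (Tok.enc p m x) = x := by
  funext c
  have hc : (c : ℕ) < m := c.2.trans_le hm
  simp [Tok.dec, FVec.num, Tok.enc, hc, Fixed.coe_clamp (hx c)]

/-- The vector of dimension `m` that holds `v` from coordinate six on. -/
def Tok.place (p m : ℕ) (v : ℕ → ℤ) : FVec p m :=
  fun c => if (c : ℕ) < 6 then Fixed.clamp p 0 else Fixed.clamp p (v (c - 6))

/-- State and head output occupy disjoint coordinates, so the residual sum stores them side by side
without loss. -/
lemma Tok.num_enc_add_place {p m : ℕ} (x : Tok) (v : ℕ → ℤ) (a : Fin m) :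
    Fixed.ofReal p ((Tok.enc p m x a).toReal + (Tok.place p m v a).toReal) =
      if h : (a : ℕ) < 6 then Fixed.clamp p (x ⟨a, h⟩) else Fixed.clamp p (v (a - 6)) := by
  by_cases h : (a : ℕ) < 6
  · simp [Tok.enc, Tok.place, h, Fixed.toReal_clamp_zero, Fixed.ofReal_toReal]
  · simp [Tok.enc, Tok.place, h, Fixed.toReal_clamp_zero, Fixed.ofReal_toReal]

/-- The layer with one head whose head output is written behind the state of the token,
followed by an update of the state. -/
def residualLayer (p m : ℕ) (A : AttentionHead p m) (F : Tok → (ℕ → ℤ) → Tok) :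
    TransformerLayer p m 1 where
  head _ := A
  mlp y := Tok.enc p m (F (Tok.dec y) fun c => y.num (6 + c))

lemma residualLayer_apply {p m N : ℕ} (hm : 6 ≤ m) (A : AttentionHead p m)
    (F : Tok → (ℕ → ℤ) → Tok) (x : Fin N → Tok) (hx : ∀ i c, |x i c| ≤ 4 ^ p) (i : Fin N)
    (v : ℕ → ℤ) (hv : ∀ c, |v c| ≤ 4 ^ p)
    (hA : A.apply (fun i => Tok.enc p m (x i)) i = Tok.place p m v) :
    (residualLayer p m A F).apply (fun i => Tok.enc p m (x i)) i =
      Tok.enc p m (F (x i) fun c => if 6 + c < m then v c else 0) := by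
  have key : (fun c => Fixed.ofReal p ((Tok.enc p m (x i) c).toReal +
      ∑ _a : Fin 1, (A.apply (fun i => Tok.enc p m (x i)) i c).toReal)) =
      fun a : Fin m => if h : (a : ℕ) < 6 then Fixed.clamp p (x i ⟨a, h⟩)
        else Fixed.clamp p (v (a - 6)) := by
    funext a
    rw [hA, Finset.univ_unique, Finset.sum_singleton, Tok.num_enc_add_place]
  simp only [TransformerLayer.apply, residualLayer]
  rw [key]
  congr 2
  · funext c
    have hc : (c : ℕ) < m := c.2.trans_le hm
    simp [Tok.dec, FVec.num, hc, Fixed.coe_clamp (hx i c)]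
  · funext c
    by_cases hc : 6 + c < m
    · simp [FVec.num, hc, Fixed.coe_clamp (hv c)]
    · simp [FVec.num, hc]

/-- The head with integer queries and keys whose value is the state of the token. -/
def readHead (p m : ℕ) (Q K : Tok → Fin m → ℤ) : AttentionHead p m where
  query y c := Fixed.clamp p (Q (Tok.dec y) c * 2 ^ p)
  key y c := Fixed.clamp p (K (Tok.dec y) c * 2 ^ p)
  value y := Tok.place p m fun c => if h : c < 6 then Tok.dec y ⟨c, h⟩ else 0

/-- The layer that reads the state of the token of highest score. -/
def readLayer (p m : ℕ) (Q K : Tok → Fin m → ℤ) (F : Tok → Tok → Tok) :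
    TransformerLayer p m 1 :=
  residualLayer p m (readHead p m Q K) fun x v => F x fun c => v c

lemma readLayer_apply {p m N : ℕ} (hm : 12 ≤ m) (hN : N ≤ 2 ^ p) (Q K : Tok → Fin m → ℤ)
    (F : Tok → Tok → Tok) (x : Fin N → Tok) (hx : ∀ i c, |x i c| ≤ 4 ^ p)
    (hQ : ∀ i c, |Q (x i) c| ≤ 2 ^ p) (hK : ∀ i c, |K (x i) c| ≤ 2 ^ p)
    (hQK : ∀ i j, |∑ c, Q (x i) c * K (x j) c| ≤ 2 ^ p) (sel : Fin N → Fin N)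
    (hsel : ∀ i j, j ≠ sel i → ∑ c, Q (x i) c * K (x j) c + (2 * p + 2) ≤
      ∑ c, Q (x i) c * K (x (sel i)) c) :
    (readLayer p m Q K F).apply (fun i => Tok.enc p m (x i)) =
      fun i => Tok.enc p m (F (x i) (x (sel i))) := by
  have hdec : ∀ i, Tok.dec (Tok.enc p m (x i)) = x i := fun i =>
    Tok.dec_enc (by omega) (hx i)
  funext i
  have hscore : ∀ j, ((readHead p m Q K).score (fun i => Tok.enc p m (x i)) i j).toReal =
      ((∑ c, Q (x i) c * K (x j) c : ℤ) : ℝ) := by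
    intro j
    apply AttentionHead.score_eq_intCast (hb := hQK i j)
    · intro c; simp only [readHead, hdec]; exact Fixed.toReal_clamp_mul (hQ i c)
    · intro c; simp only [readHead, hdec]; exact Fixed.toReal_clamp_mul (hK j c)
  rw [readLayer, residualLayer_apply (by omega) _ _ x hx i
    (fun c => if h : c < 6 then x (sel i) ⟨c, h⟩ else 0)]
  · congr 2
    funext c
    have h1 := c.2
    have : 6 + (c : ℕ) < m := by omega
    simp [this]
  · intro c
    split_ifs
    · exact hx _ _
    · simp
  · rw [AttentionHead.apply_of_gap hN _ _ i (sel i)]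
    · simp [readHead, hdec]
    · intro j hj
      rw [hscore, hscore]
      exact_mod_cast hsel i j hj

/-! ## Layers that count -/

/-- The head that attends to all tokens uniformly; its values are indicators. -/
def countHead (p m : ℕ) (χ : Tok → ℕ → Bool) : AttentionHead p m where
  query _ _ := Fixed.clamp p 0
  key _ _ := Fixed.clamp p 0
  value y := Tok.place p m fun c => if χ (Tok.dec y) c then 2 ^ p else 0

/-- The layer that counts, up to a common factor, the tokens with given properties. -/
def countLayer (p m : ℕ) (χ : Tok → ℕ → Bool) (F : Tok → (ℕ → ℤ) → Tok) :
    TransformerLayer p m 1 :=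
  residualLayer p m (countHead p m χ) F

/-- All weights are rounded to the same `w / 2 ^ p`, and `w` is positive because `N ≤ 2 ^ p`. The
rounding error is thus one common factor on all counts, which can still be compared exactly. -/
lemma countLayer_apply {p m N : ℕ} (hm : 6 ≤ m) (hN0 : 0 < N) (hN : N ≤ 2 ^ p)
    (χ : Tok → ℕ → Bool) (F : Tok → (ℕ → ℤ) → Tok) (x : Fin N → Tok)
    (hx : ∀ i c, |x i c| ≤ 4 ^ p) :
    ∃ w : ℤ, 0 < w ∧ (countLayer p m χ F).apply (fun i => Tok.enc p m (x i)) =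
      fun i => Tok.enc p m (F (x i) fun c =>
        if 6 + c < m then w * (Finset.univ.filter fun j => χ (x j) c = true).card else 0) := by
  have hdec : ∀ i, Tok.dec (Tok.enc p m (x i)) = x i := fun i => Tok.dec_enc hm (hx i)
  have hNR : (0 : ℝ) < N := by exact_mod_cast hN0
  have hNp : (N : ℝ) ≤ 2 ^ p := by exact_mod_cast hN
  set w : ℤ := round ((1 : ℝ) / N * 2 ^ p) with hw
  have hw1 : 1 ≤ w := by
    have h1 : (1 : ℝ) ≤ (1 : ℝ) / N * 2 ^ p := by
      rw [div_mul_eq_mul_div, one_mul, le_div_iff₀ hNR]; linarith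
    rw [hw, round_eq, Int.le_floor]
    push_cast
    linarith
  have hw2 : w ≤ 2 ^ p := by
    have h1 : (1 : ℝ) / N * 2 ^ p ≤ ((2 ^ p : ℤ) : ℝ) := by
      push_cast
      rw [div_mul_eq_mul_div, one_mul, div_le_iff₀ hNR]
      have : (1 : ℝ) ≤ N := by exact_mod_cast hN0
      have : (0 : ℝ) < 2 ^ p := by positivity
      nlinarith
    have h2 : (w : ℝ) < ((2 ^ p + 1 : ℤ) : ℝ) := by
      have h3 := Int.floor_le ((1 : ℝ) / N * 2 ^ p + 1 / 2)
      rw [hw, round_eq]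
      push_cast at h1 ⊢
      linarith
    have h3 := Int.cast_lt.mp h2
    omega
  have h4 : (4 : ℤ) ^ p = 2 ^ p * 2 ^ p := by rw [← mul_pow]; norm_num
  have h2p : (1 : ℤ) ≤ 2 ^ p := one_le_pow₀ (by norm_num)
  have hcard : ∀ c, ((Finset.univ.filter fun j => χ (x j) c = true).card : ℤ) ≤ 2 ^ p := by
    intro c
    have : (Finset.univ.filter fun j => χ (x j) c = true).card ≤ 2 ^ p :=
      (Finset.card_le_univ _).trans (by simpa using hN)
    exact_mod_cast this
  have hbound : ∀ c, |w * ((Finset.univ.filter fun j => χ (x j) c = true).card : ℤ)| ≤ 4 ^ p := by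
    intro c
    rw [abs_of_nonneg (by positivity), h4]
    exact mul_le_mul hw2 (hcard c) (by positivity) (by positivity)
  refine ⟨w, by omega, ?_⟩
  funext i
  rw [countLayer, residualLayer_apply hm _ _ x hx i _ hbound]
  have hweight : ∀ j, ((countHead p m χ).weight (fun i => Tok.enc p m (x i)) i j).toReal =
      (w : ℝ) / 2 ^ p := by
    intro j
    have hs : ∀ j, ((countHead p m χ).score (fun i => Tok.enc p m (x i)) i j).toReal = 0 := by
      intro j
      rw [AttentionHead.score_eq_intCast (q := fun _ => 0) (k := fun _ => 0)]
      · simp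
      · intro c; simp [countHead, Fixed.toReal_clamp_zero]
      · intro c; simp [countHead, Fixed.toReal_clamp_zero]
      · simp
    simp only [AttentionHead.weight, hs]
    simp only [Real.exp_zero, Finset.sum_const, Finset.card_univ, Fintype.card_fin, nsmul_eq_mul,
      mul_one]
    rw [Fixed.ofReal_eq_clamp, ← hw, Fixed.toReal, Fixed.coe_clamp]
    rw [abs_of_nonneg (by omega), h4]
    nlinarith
  funext a
  simp only [AttentionHead.apply, hweight]
  by_cases ha : (a : ℕ) < 6
  · simp only [countHead, Tok.place, ha, if_true, Fixed.toReal_clamp_zero, mul_zero,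
      Finset.sum_const_zero]
    simpa using Fixed.ofReal_div p 0
  · have hval : ∀ j, ((countHead p m χ).value (Tok.enc p m (x j)) a).toReal =
        if χ (x j) (a - 6) then 1 else 0 := by
      intro j
      simp only [countHead, Tok.place, ha, if_false, hdec]
      split_ifs
      · simpa using Fixed.toReal_clamp_mul (p := p) (z := 1) (by simpa using h2p)
      · exact Fixed.toReal_clamp_zero p
    simp only [hval, Tok.place, ha, if_false]
    rw [← Finset.mul_sum, Finset.sum_boole, ← Fixed.ofReal_div]
    congr 1
    push_cast
    ring

/-! ## Families of two-colourings that separate all pairs -/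

/-- The involution of two-colourings that changes the colour of `a`. -/
def flipAt {α : Type*} [DecidableEq α] (a : α) : (α → Bool) ≃ (α → Bool) :=
  Function.Involutive.toPerm (fun g => Function.update g a (!g a)) fun g => by
    funext x
    by_cases hx : x = a
    · subst hx; simp
    · simp [hx]

lemma flipAt_apply {α : Type*} [DecidableEq α] (a : α) (g : α → Bool) :
    flipAt a g = Function.update g a (!g a) := rfl

/-- Flipping the colours of `a` and of `b` runs through the four colour pairs, exactly one of which
has weight `1 / 2`; the mean is `(1 / 2 + 1 + 1 + 1) / 4 = 7 / 8`. -/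
lemma sum_separating_weight {α : Type*} [Fintype α] [DecidableEq α] {a b : α} (hab : a ≠ b) :
    ∑ g : α → Bool, (if g a = true ∧ g b = false then (1 / 2 : ℚ) else 1) =
      ∑ _g : α → Bool, (7 / 8 : ℚ) := by
  set f : (α → Bool) → ℚ := fun g => if g a = true ∧ g b = false then (1 / 2 : ℚ) else 1 with hf
  have h1 := Equiv.sum_comp (flipAt a) f
  have h2 := Equiv.sum_comp (flipAt b) f
  have h3 := Equiv.sum_comp ((flipAt a).trans (flipAt b)) f
  have h4 : ∑ g, f g + ∑ g, f (flipAt a g) + ∑ g, f (flipAt b g) +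
      ∑ g, f ((flipAt a).trans (flipAt b) g) = ∑ _g : α → Bool, (7 / 2 : ℚ) := by
    rw [← Finset.sum_add_distrib, ← Finset.sum_add_distrib, ← Finset.sum_add_distrib]
    refine Finset.sum_congr rfl fun g _ => ?_
    simp only [hf, flipAt_apply, Equiv.trans_apply,
      Function.update_self, Function.update_of_ne hab, Function.update_of_ne hab.symm]
    cases g a <;> cases g b <;> norm_num
  rw [h1, h2, h3] at h4
  have h5 : ∑ _g : α → Bool, (7 / 2 : ℚ) = 4 * ∑ _g : α → Bool, (7 / 8 : ℚ) := by
    rw [Finset.mul_sum]; norm_num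
  linarith

/-- Method of conditional expectations: the potential halves the weight of a pair each time it is
separated. A uniformly random further colouring multiplies it by `7 / 8` on average, so some
colouring does at least as well. -/
lemma exists_coloring_family {α : Type*} [Fintype α] [DecidableEq α] (n : ℕ) :
    ∃ h : ℕ → α → Bool, ∑ q ∈ (Finset.univ : Finset (α × α)).filter (fun q => q.1 ≠ q.2),
      (1 / 2 : ℚ) ^ ((Finset.range n).filter fun s => h s q.1 = true ∧ h s q.2 = false).card ≤
        (Fintype.card α : ℚ) ^ 2 * (7 / 8) ^ n := by
  induction n with
  | zero =>
    refine ⟨fun _ _ => true, ?_⟩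
    simp only [Finset.range_zero, Finset.filter_empty, Finset.card_empty, pow_zero,
      Finset.sum_const, nsmul_eq_mul, mul_one]
    have : ((Finset.univ : Finset (α × α)).filter (fun q => q.1 ≠ q.2)).card ≤
        Fintype.card α ^ 2 := by
      refine (Finset.card_le_univ _).trans ?_
      rw [Fintype.card_prod, sq]
    exact_mod_cast this
  | succ n ih =>
    obtain ⟨h, hh⟩ := ih
    set D := (Finset.univ : Finset (α × α)).filter (fun q => q.1 ≠ q.2) with hD
    set w : α × α → ℚ := fun q =>
      (1 / 2 : ℚ) ^ ((Finset.range n).filter fun s => h s q.1 = true ∧ h s q.2 = false).card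
    have havg : ∑ g : α → Bool, ∑ q ∈ D,
        w q * (if g q.1 = true ∧ g q.2 = false then (1 / 2 : ℚ) else 1) =
        ∑ _g : α → Bool, (7 / 8) * ∑ q ∈ D, w q := by
      rw [Finset.sum_comm]
      calc ∑ q ∈ D, ∑ g : α → Bool,
            w q * (if g q.1 = true ∧ g q.2 = false then (1 / 2 : ℚ) else 1)
          = ∑ q ∈ D, w q * ∑ _g : α → Bool, (7 / 8 : ℚ) := by
            refine Finset.sum_congr rfl fun q hq => ?_
            rw [← Finset.mul_sum, sum_separating_weight (by simpa [hD] using hq)]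
        _ = _ := by
            rw [← Finset.sum_mul]
            simp only [Finset.sum_const, nsmul_eq_mul]
            ring
    obtain ⟨g, -, hg⟩ := Finset.exists_le_of_sum_le Finset.univ_nonempty havg.le
    refine ⟨Function.update h n g, ?_⟩
    calc _ = ∑ q ∈ D, w q * (if g q.1 = true ∧ g q.2 = false then (1 / 2 : ℚ) else 1) := by
          refine Finset.sum_congr rfl fun q _ => ?_
          have hfil : (Finset.range n).filter (fun s => Function.update h n g s q.1 = true ∧
              Function.update h n g s q.2 = false) =
              (Finset.range n).filter fun s => h s q.1 = true ∧ h s q.2 = false := by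
            refine Finset.filter_congr fun s hs => ?_
            rw [Function.update_of_ne (Finset.mem_range.mp hs).ne]
          rw [Finset.range_add_one, Finset.filter_insert, Function.update_self]
          split_ifs with hc
          · rw [Finset.card_insert_of_notMem (by simp), hfil, pow_succ]
          · rw [hfil, mul_one]
      _ ≤ 7 / 8 * ∑ q ∈ D, w q := hg
      _ ≤ 7 / 8 * ((Fintype.card α : ℚ) ^ 2 * (7 / 8) ^ n) := by gcongr
      _ = _ := by ring

/-- There are `16 * t` two-colourings of `2 ^ t` points such that a sixteenth of them colour
the first of any two points `true` and the second `false`. -/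
lemma exists_separating_family {K t : ℕ} (hK : K ≤ 2 ^ t) :
    ∃ h : ℕ → ℤ → Bool, ∀ a b : ℤ, 0 ≤ a → a < K → 0 ≤ b → b < K → a ≠ b →
      t ≤ ((Finset.range (16 * t)).filter fun s => h s a = true ∧ h s b = false).card := by
  obtain ⟨h, hh⟩ := exists_coloring_family (α := Fin K) (16 * t)
  refine ⟨fun s a => if ha : 0 ≤ a ∧ a < K then h s ⟨a.toNat, by omega⟩ else false, ?_⟩
  intro a b ha0 haK hb0 hbK hab
  simp only [ha0, haK, hb0, hbK, and_self, dite_true]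
  set a' : Fin K := ⟨a.toNat, by omega⟩
  set b' : Fin K := ⟨b.toNat, by omega⟩
  have hab' : a' ≠ b' := by
    intro he
    have := congrArg Fin.val he
    simp only [a', b'] at this
    omega
  have hle := (Finset.single_le_sum (f := fun q : Fin K × Fin K => (1 / 2 : ℚ) ^
    ((Finset.range (16 * t)).filter fun s => h s q.1 = true ∧ h s q.2 = false).card)
    (fun _ _ => by positivity) (by simpa using hab' :
      (a', b') ∈ (Finset.univ : Finset (Fin K × Fin K)).filter (fun q => q.1 ≠ q.2))).trans hh
  by_contra! hlt
  simp only [Fintype.card_fin] at hle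
  have h1 : (1 / 2 : ℚ) ^ t < (1 / 2 : ℚ) ^
      ((Finset.range (16 * t)).filter fun s => h s a' = true ∧ h s b' = false).card :=
    pow_lt_pow_right_of_lt_one₀ (by norm_num) (by norm_num) hlt
  -- The factor 16 comes from here: `4 * (7 / 8) ^ 16 ≤ 1 / 2`. A pair separated fewer than `t`
  -- times would alone exceed the whole potential.
  have h2 : (K : ℚ) ^ 2 * (7 / 8) ^ (16 * t) ≤ (1 / 2 : ℚ) ^ t := by
    have hK' : (K : ℚ) ≤ 2 ^ t := by exact_mod_cast hK
    calc (K : ℚ) ^ 2 * (7 / 8) ^ (16 * t) ≤ (2 ^ t) ^ 2 * ((7 / 8) ^ 16) ^ t := by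
          rw [pow_mul]; gcongr
      _ = (4 * (7 / 8) ^ 16) ^ t := by rw [← pow_mul, mul_comm t 2, pow_mul, ← mul_pow]; norm_num
      _ ≤ (1 / 2) ^ t := by
          apply pow_le_pow_left₀ <;> norm_num
  linarith

/-! ## Reading the token that is best for a quadratic score -/

/-- Vanishes if and only if the edges of the two tokens share a node. -/
def Tok.res (x y : Tok) : ℤ :=
  (x 0 - y 0) * (x 0 - y 1) * ((x 1 - y 0) * (x 1 - y 1))

lemma Tok.res_eq_zero {x y : Tok} :
    x.res y = 0 ↔ (x 0 = y 0 ∨ x 0 = y 1) ∨ (x 1 = y 0 ∨ x 1 = y 1) := by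
  simp [Tok.res, sub_eq_zero]

/-- The features of a query edge that enter the bilinear form `Tok.res`. -/
def Tok.resQuery (x : Tok) : Fin 6 → ℤ :=
  ![(x 0 * x 1) * (x 0 * x 1), (x 0 + x 1) * (x 0 + x 1) - 2 * (x 0 * x 1), 1, x 0 * x 1,
    -(x 0 + x 1), -((x 0 + x 1) * (x 0 * x 1))]

/-- The features of a key edge that enter the bilinear form `Tok.res`. -/
def Tok.resKey (y : Tok) : Fin 6 → ℤ :=
  ![1, y 0 * y 1, (y 0 * y 1) * (y 0 * y 1), (y 0 + y 1) * (y 0 + y 1),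
    (y 0 + y 1) * (y 0 * y 1), y 0 + y 1]

/-- This is the resultant of the two monic quadratics with the end points as roots. Being symmetric
in each pair of roots, it is a polynomial in their sums and products, and six products of a query
and a key feature suffice. -/
lemma Tok.res_eq_sum (x y : Tok) : x.res y = ∑ c, x.resQuery c * y.resKey c := by
  simp [Tok.res, Tok.resQuery, Tok.resKey, Fin.sum_univ_succ]
  ring

/-- The priority of the key token `y` for the query token `x`. -/
def Tok.prio (α : Tok → ℤ) (β Γ : ℤ) (x y : Tok) : ℤ :=
  α y - β * (x 3 - y 3) ^ 2 - Γ * x.res y ^ 2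

/-- The query features of the score of `Tok.prio` with ties broken by positions. -/
def Tok.scoreQuery (X γ β Γ : ℤ) (x : Tok) : Fin 4 ⊕ (Fin 6 × Fin 6) → ℤ :=
  Sum.elim (γ • ![1, -(X * β) * (x 3 * x 3), 2 * (X * β) * x 3, -(X * β)])
    fun q => γ * (-(X * Γ) * (x.resQuery q.1 * x.resQuery q.2))

/-- The key features of the score of `Tok.prio` with ties broken by positions. -/
def Tok.scoreKey (X : ℤ) (α : Tok → ℤ) (y : Tok) : Fin 4 ⊕ (Fin 6 × Fin 6) → ℤ :=
  Sum.elim ![X * α y + y 2, 1, y 3, y 3 * y 3] fun q => y.resKey q.1 * y.resKey q.2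

/-- Squaring `Tok.res` takes 36 features; `α` with the position takes one and the squared label
distance three. The position is less than `X`, so it only breaks ties; `γ` stretches unit
differences to the gap required by the softmax. -/
lemma Tok.sum_score (X γ : ℤ) (α : Tok → ℤ) (β Γ : ℤ) (x y : Tok) :
    ∑ c, x.scoreQuery X γ β Γ c * y.scoreKey X α c = γ * (X * Tok.prio α β Γ x y + y 2) := by
  rw [Fintype.sum_sum_type]
  have h : ∑ q : Fin 6 × Fin 6, x.scoreQuery X γ β Γ (Sum.inr q) * y.scoreKey X α (Sum.inr q) =
      γ * (-(X * Γ) * x.res y ^ 2) := by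
    rw [sq, Tok.res_eq_sum, Finset.sum_mul_sum, ← Finset.sum_product', Finset.mul_sum,
      Finset.mul_sum, Finset.univ_product_univ]
    refine Finset.sum_congr rfl fun q _ => ?_
    simp only [Tok.scoreQuery, Tok.scoreKey, Sum.elim_inr]
    ring
  rw [h]
  simp [Tok.scoreQuery, Tok.scoreKey, Fin.sum_univ_succ, Tok.prio]
  ring

/-! ### Sizes of the features, in powers of `X`. -/

section Bounds

variable {X : ℤ}

lemma abs_mul_le_pow {a b : ℤ} {i j : ℕ} (ha : |a| ≤ X ^ i) (hb : |b| ≤ X ^ j) :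
    |a * b| ≤ X ^ (i + j) := by
  rw [abs_mul, pow_add]
  exact mul_le_mul ha hb (abs_nonneg _) ((abs_nonneg _).trans ha)

lemma abs_le_pow_of_le (hX : 2 ≤ X) {a : ℤ} {i j : ℕ} (ha : |a| ≤ X ^ i) (hij : i ≤ j) :
    |a| ≤ X ^ j :=
  ha.trans (pow_le_pow_right₀ (by omega) hij)

lemma abs_add_le_pow (hX : 2 ≤ X) {a b : ℤ} {i : ℕ} (ha : |a| ≤ X ^ i) (hb : |b| ≤ X ^ i) :
    |a + b| ≤ X ^ (i + 1) := by
  have h := abs_add_le a b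
  have h1 : (0 : ℤ) ≤ X ^ i := by positivity
  rw [pow_succ]
  nlinarith

lemma Tok.abs_resQuery_le (hX : 2 ≤ X) {x : Tok} (hx : ∀ c, |x c| ≤ X ^ 2) (c : Fin 6) :
    |x.resQuery c| ≤ X ^ 8 := by
  have h2 : |(2 : ℤ)| ≤ X ^ 1 := by simpa using hX
  have hb := abs_mul_le_pow (hx 0) (hx 1)
  have ha := abs_add_le_pow hX (hx 0) (hx 1)
  have h1 := abs_mul_le_pow hb hb
  have h3 := abs_add_le_pow hX (abs_mul_le_pow ha ha)
    (b := -(2 * (x 0 * x 1))) (by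
      rw [abs_neg]; exact abs_le_pow_of_le hX (abs_mul_le_pow h2 hb) (by norm_num))
  have h4 := abs_mul_le_pow ha hb
  fin_cases c
  · exact abs_le_pow_of_le hX h1 (by norm_num)
  · exact abs_le_pow_of_le hX h3 (by norm_num)
  · exact abs_le_pow_of_le hX (i := 0) (by simp [Tok.resQuery]) (by norm_num)
  · exact abs_le_pow_of_le hX hb (by norm_num)
  · exact abs_le_pow_of_le hX ((abs_neg _).trans_le ha) (by norm_num)
  · exact abs_le_pow_of_le hX ((abs_neg _).trans_le h4) (by norm_num)

lemma Tok.abs_resKey_le (hX : 2 ≤ X) {x : Tok} (hx : ∀ c, |x c| ≤ X ^ 2) (c : Fin 6) :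
    |x.resKey c| ≤ X ^ 8 := by
  have hb := abs_mul_le_pow (hx 0) (hx 1)
  have ha := abs_add_le_pow hX (hx 0) (hx 1)
  have h1 := abs_mul_le_pow hb hb
  have h3 := abs_mul_le_pow ha ha
  have h4 := abs_mul_le_pow ha hb
  fin_cases c
  · exact abs_le_pow_of_le hX (i := 0) (by simp [Tok.resKey]) (by norm_num)
  · exact abs_le_pow_of_le hX hb (by norm_num)
  · exact abs_le_pow_of_le hX h1 (by norm_num)
  · exact abs_le_pow_of_le hX h3 (by norm_num)
  · exact abs_le_pow_of_le hX h4 (by norm_num)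
  · exact abs_le_pow_of_le hX ha (by norm_num)

lemma Tok.abs_scoreQuery_le (hX : 2 ≤ X) {γ β Γ : ℤ} (hγ : |γ| ≤ X ^ 5) (hβ : |β| ≤ X ^ 5)
    (hΓ : |Γ| ≤ X ^ 5) {x : Tok} (hx : ∀ c, |x c| ≤ X ^ 2) (c : Fin 4 ⊕ (Fin 6 × Fin 6)) :
    |x.scoreQuery X γ β Γ c| ≤ X ^ 40 := by
  have h2 : |(2 : ℤ)| ≤ X ^ 1 := by simpa using hX
  have hX1 : |X| ≤ X ^ 1 := by rw [pow_one, abs_of_nonneg (by omega)]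
  have hβ' := abs_mul_le_pow hX1 hβ
  have hβ'' : |-(X * β)| ≤ _ := (abs_neg _).trans_le hβ'
  have hΓ' : |-(X * Γ)| ≤ _ := (abs_neg _).trans_le (abs_mul_le_pow hX1 hΓ)
  rcases c with c | q
  · fin_cases c
    · exact abs_le_pow_of_le hX (i := 5) (by simpa [Tok.scoreQuery] using hγ) (by norm_num)
    · exact abs_le_pow_of_le hX (abs_mul_le_pow hγ
        (abs_mul_le_pow hβ'' (abs_mul_le_pow (hx 3) (hx 3)))) (by norm_num)
    · exact abs_le_pow_of_le hX (abs_mul_le_pow hγ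
        (abs_mul_le_pow (abs_mul_le_pow h2 hβ') (hx 3))) (by norm_num)
    · exact abs_le_pow_of_le hX (abs_mul_le_pow hγ hβ'') (by norm_num)
  · exact abs_le_pow_of_le hX (abs_mul_le_pow hγ (abs_mul_le_pow hΓ'
      (abs_mul_le_pow (Tok.abs_resQuery_le hX hx _) (Tok.abs_resQuery_le hX hx _))))
      (by norm_num)

lemma Tok.abs_scoreKey_le (hX : 2 ≤ X) {α : Tok → ℤ} {y : Tok} (hα : |α y| ≤ X ^ 5)
    (hy : ∀ c, |y c| ≤ X ^ 2) (c : Fin 4 ⊕ (Fin 6 × Fin 6)) :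
    |y.scoreKey X α c| ≤ X ^ 40 := by
  have hX1 : |X| ≤ X ^ 1 := by rw [pow_one, abs_of_nonneg (by omega)]
  rcases c with c | q
  · fin_cases c
    · exact abs_le_pow_of_le hX (abs_add_le_pow hX (abs_mul_le_pow hX1 hα)
        (abs_le_pow_of_le hX (hy 2) (by norm_num))) (by norm_num)
    · exact abs_le_pow_of_le hX (i := 0) (by simp [Tok.scoreKey]) (by norm_num)
    · exact abs_le_pow_of_le hX (hy 3) (by norm_num)
    · exact abs_le_pow_of_le hX (abs_mul_le_pow (hy 3) (hy 3)) (by norm_num)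
  · exact abs_le_pow_of_le hX
      (abs_mul_le_pow (Tok.abs_resKey_le hX hy _) (Tok.abs_resKey_le hX hy _)) (by norm_num)

end Bounds

/-- Extension of a vector by zeros along an injection preserves inner products. -/
lemma sum_extend_mul_extend {ι κ : Type*} [Fintype ι] [Fintype κ] (e : ι ↪ κ) (f g : ι → ℤ) :
    ∑ c, Function.extend e f 0 c * Function.extend e g 0 c = ∑ i, f i * g i := by
  classical
  rw [← Finset.sum_subset (Finset.subset_univ (Finset.univ.map e)), Finset.sum_map]
  · exact Finset.sum_congr rfl fun i _ => by rw [e.injective.extend_apply, e.injective.extend_apply]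
  · intro c _ hc
    rw [Function.extend_apply' _ _ _ (by simpa using hc)]
    simp

lemma abs_extend_le {ι κ : Type*} (e : ι ↪ κ) (f : ι → ℤ) {B : ℤ} (hB : 0 ≤ B)
    (hf : ∀ i, |f i| ≤ B) (c : κ) : |Function.extend e f 0 c| ≤ B := by
  by_cases hc : ∃ i, e i = c
  · obtain ⟨i, rfl⟩ := hc
    rw [e.injective.extend_apply]; exact hf i
  · rw [Function.extend_apply' _ _ _ hc]; simpa using hB

/-- Token states with small entries that know their positions. -/
structure Tok.Valid {N : ℕ} (X : ℤ) (x : Fin N → Tok) : Prop where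
  bound : ∀ i c, |x i c| ≤ X ^ 2
  pos : ∀ i, x i 2 = (i : ℕ)

/-- `sel i` is the token that is best for token `i`, ties being broken by positions. -/
def Tok.IsBest {N : ℕ} (X : ℤ) (α : Tok → ℤ) (β Γ : ℤ) (x : Fin N → Tok)
    (sel : Fin N → Fin N) : Prop :=
  ∀ i j, X * Tok.prio α β Γ (x i) (x j) + x j 2 ≤
    X * Tok.prio α β Γ (x i) (x (sel i)) + x (sel i) 2

/-- Positions lie in `[0, X)`, so they can be recovered as remainders modulo `X`. -/
lemma Tok.eq_of_prio_eq {N : ℕ} {X : ℤ} (hNX : N ≤ X) {x : Fin N → Tok}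
    (hx : Tok.Valid X x) {a b : ℤ} {j j' : Fin N} (h : X * a + x j 2 = X * b + x j' 2) :
    j = j' := by
  rw [hx.pos, hx.pos] at h
  have h1 := j.2
  have h2 := j'.2
  have hab : a = b := by
    by_contra hne
    rcases lt_or_gt_of_ne hne with hlt | hlt <;> nlinarith
  subst hab
  apply Fin.ext
  omega

lemma Tok.IsBest.prio_le {N : ℕ} {X : ℤ} (hNX : N ≤ X) {α : Tok → ℤ} {β Γ : ℤ}
    {x : Fin N → Tok} (hx : Tok.Valid X x) {sel : Fin N → Fin N}
    (h : Tok.IsBest X α β Γ x sel) (i j : Fin N) :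
    Tok.prio α β Γ (x i) (x j) ≤ Tok.prio α β Γ (x i) (x (sel i)) := by
  have h0 := h i j
  rw [hx.pos, hx.pos] at h0
  have h1 := j.2
  have h2 := (sel i).2
  by_contra! hlt
  nlinarith

/-- A layer reads, at every token, the state of the token of highest priority. -/
lemma exists_prioLayer {l p m : ℕ} (hl : 2 ≤ l) (hp : p = 100 * l) (hm : 40 ≤ m)
    (α : Tok → ℤ) (β Γ : ℤ) (F : Tok → Tok → Tok)
    (hα : ∀ y : Tok, (∀ c, |y c| ≤ ((2 : ℤ) ^ l) ^ 2) → |α y| ≤ ((2 : ℤ) ^ l) ^ 5)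
    (hβ : |β| ≤ ((2 : ℤ) ^ l) ^ 5) (hΓ : |Γ| ≤ ((2 : ℤ) ^ l) ^ 5) :
    ∃ L : TransformerLayer p m 1, ∀ (N : ℕ) (x : Fin N → Tok), (N : ℤ) ≤ 2 ^ l →
      Tok.Valid (2 ^ l) x → ∃ sel, Tok.IsBest (2 ^ l) α β Γ x sel ∧
        L.apply (fun i => Tok.enc p m (x i)) = fun i => Tok.enc p m (F (x i) (x (sel i))) := by
  obtain ⟨e⟩ : Nonempty ((Fin 4 ⊕ (Fin 6 × Fin 6)) ↪ Fin m) :=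
    Function.Embedding.nonempty_of_card_le (by simpa using hm)
  set X : ℤ := 2 ^ l with hX
  have hX4 : 4 ≤ X := by
    calc (4 : ℤ) = 2 ^ 2 := by norm_num
      _ ≤ 2 ^ l := pow_le_pow_right₀ (by norm_num) hl
  have hX2 : 2 ≤ X := by omega
  have hXp : X ^ 100 = 2 ^ p := by rw [hX, ← pow_mul, hp, mul_comm]
  have hle : ∀ i ≤ 100, X ^ i ≤ 2 ^ p := fun i hi => by
    rw [← hXp]; exact pow_le_pow_right₀ (by omega) hi
  have hγ : |((2 * p + 2 : ℕ) : ℤ)| ≤ X ^ 5 := by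
    have h1 : (l : ℤ) ≤ X := by
      have : l < 2 ^ l := Nat.lt_two_pow_self
      rw [hX]; exact_mod_cast this.le
    have h2 : (256 : ℤ) ≤ X ^ 4 := by
      calc (256 : ℤ) = 4 ^ 4 := by norm_num
        _ ≤ X ^ 4 := by gcongr
    rw [abs_of_nonneg (by positivity), pow_succ]
    push_cast [hp]
    nlinarith
  refine ⟨readLayer p m (fun x => Function.extend e (x.scoreQuery X (2 * p + 2 : ℕ) β Γ) 0)
    (fun y => Function.extend e (y.scoreKey X α) 0) F, fun N x hN hx => ?_⟩
  have hbest : ∀ i, ∃ j₀, ∀ j, X * Tok.prio α β Γ (x i) (x j) + x j 2 ≤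
      X * Tok.prio α β Γ (x i) (x j₀) + x j₀ 2 := by
    intro i
    have : Nonempty (Fin N) := ⟨i⟩
    exact Finite.exists_max fun j => X * Tok.prio α β Γ (x i) (x j) + x j 2
  choose sel hsel using hbest
  refine ⟨sel, hsel, ?_⟩
  have hQ : ∀ i c, |(x i).scoreQuery X (2 * p + 2 : ℕ) β Γ c| ≤ X ^ 40 := fun i c =>
    Tok.abs_scoreQuery_le hX2 hγ hβ hΓ (hx.bound i) c
  have hK : ∀ i c, |(x i).scoreKey X α c| ≤ X ^ 40 := fun i c =>
    Tok.abs_scoreKey_le hX2 (hα _ (hx.bound i)) (hx.bound i) c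
  apply readLayer_apply (by omega) (sel := sel)
  · have : (N : ℤ) ≤ 2 ^ p := hN.trans (by simpa using hle 1 (by norm_num))
    exact_mod_cast this
  · intro i c
    refine (hx.bound i c).trans ((hle 2 (by norm_num)).trans ?_)
    exact pow_le_pow_left₀ (by norm_num) (by norm_num) p
  · exact fun i c => (abs_extend_le e _ (by positivity) (hQ i) c).trans (hle 40 (by norm_num))
  · exact fun i c => (abs_extend_le e _ (by positivity) (hK i) c).trans (hle 40 (by norm_num))
  · intro i j
    rw [sum_extend_mul_extend]
    calc |∑ c, (x i).scoreQuery X (2 * p + 2 : ℕ) β Γ c * (x j).scoreKey X α c|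
        ≤ ∑ c, |(x i).scoreQuery X (2 * p + 2 : ℕ) β Γ c * (x j).scoreKey X α c| :=
          Finset.abs_sum_le_sum_abs _ _
      _ ≤ ∑ _c : Fin 4 ⊕ (Fin 6 × Fin 6), X ^ 80 :=
          Finset.sum_le_sum fun c _ => abs_mul_le_pow (i := 40) (j := 40) (hQ i c) (hK j c)
      _ = 40 * X ^ 80 := by simp
      _ ≤ X ^ 3 * X ^ 80 := by
          gcongr
          calc (40 : ℤ) ≤ 4 ^ 3 := by norm_num
            _ ≤ X ^ 3 := by gcongr
      _ ≤ 2 ^ p := by rw [← pow_add]; exact hle _ (by norm_num)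
  · intro i j hj
    rw [sum_extend_mul_extend, sum_extend_mul_extend, Tok.sum_score, Tok.sum_score]
    have h1 := hsel i j
    have h2 : X * Tok.prio α β Γ (x i) (x j) + x j 2 ≠
        X * Tok.prio α β Γ (x i) (x (sel i)) + x (sel i) 2 := fun he =>
      hj (Tok.eq_of_prio_eq hN hx he)
    -- Different integers differ by at least one, and the factor `2 * p + 2` in the score makes this
    -- the required gap.
    have h3 := lt_of_le_of_ne h1 h2
    push_cast
    nlinarith

/-! ## Merging components -/

lemma Tok.res_self (x : Tok) : x.res x = 0 := by simp [Tok.res_eq_zero]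

lemma Tok.res_comm_zero {x y : Tok} (h : x.res y = 0) : y.res x = 0 := by
  rw [Tok.res_eq_zero] at h ⊢
  rcases h with (h | h) | (h | h) <;> simp [h]

/-- The result of a list of transformer layers. -/
noncomputable def runLayers {p m H N : ℕ} (Ls : List (TransformerLayer p m H))
    (X : Fin N → FVec p m) : Fin N → FVec p m :=
  Ls.foldl (fun Y A => A.apply Y) X

lemma runLayers_append {p m H N : ℕ} (L L' : List (TransformerLayer p m H))
    (X : Fin N → FVec p m) : runLayers (L ++ L') X = runLayers L' (runLayers L X) :=
  List.foldl_append

lemma runLayers_cons {p m H N : ℕ} (A : TransformerLayer p m H)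
    (L : List (TransformerLayer p m H)) (X : Fin N → FVec p m) :
    runLayers (A :: L) X = runLayers L (A.apply X) :=
  List.foldl_cons ..

lemma runLayers_nil {p m H N : ℕ} (X : Fin N → FVec p m) :
    runLayers ([] : List (TransformerLayer p m H)) X = X := rfl

/-- The labels of components that meet a component with another label. -/
noncomputable def activeLabels {N : ℕ} (x : Fin N → Tok) : Finset ℤ := by
  classical
  exact (Finset.univ.filter fun i => ∃ j, (x i).res (x j) = 0 ∧ x j 3 ≠ x i 3).image fun i => x i 3

lemma mem_activeLabels {N : ℕ} {x : Fin N → Tok} {a : ℤ} :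
    a ∈ activeLabels x ↔ ∃ i j, (x i).res (x j) = 0 ∧ x j 3 ≠ x i 3 ∧ x i 3 = a := by
  simp only [activeLabels, Finset.mem_image, Finset.mem_filter, Finset.mem_univ, true_and]
  constructor
  · rintro ⟨i, ⟨j, h1, h2⟩, h3⟩; exact ⟨i, j, h1, h2, h3⟩
  · rintro ⟨i, j, h1, h2, h3⟩; exact ⟨i, ⟨j, h1, h2⟩, h3⟩

/-- The update after reading the farthest label among the tokens that share a node. -/
def meetUpdate (x y : Tok) : Tok := ![x 0, x 1, x 2, x 3, y 3, 0]

/-- The update after reading the representative of the own component. -/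
def leadUpdate (x y : Tok) : Tok := ![x 0, x 1, x 2, x 3, y 4, if y 2 = x 2 then 1 else 0]

/-- The component of `x` may be merged into the proposed one, by the two-colouring `f`. -/
def Tok.hooks (f : ℤ → Bool) (x : Tok) : Bool := f (x 3) && !f (x 4)

/-- A place below `S` where `v` is largest. -/
noncomputable def pickMax (S : ℕ) (v : ℕ → ℤ) : ℕ := by
  classical
  exact if h : ∃ s ∈ Finset.range S, ∀ s' ∈ Finset.range S, v s' ≤ v s then h.choose else 0

lemma pickMax_spec {S : ℕ} (hS : 0 < S) (v : ℕ → ℤ) :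
    pickMax S v < S ∧ ∀ s < S, v s ≤ v (pickMax S v) := by
  have h : ∃ s ∈ Finset.range S, ∀ s' ∈ Finset.range S, v s' ≤ v s :=
    Finset.exists_max_image _ v ⟨0, by simpa using hS⟩
  unfold pickMax
  rw [dif_pos h]
  exact ⟨Finset.mem_range.mp h.choose_spec.1, fun s hs =>
    h.choose_spec.2 s (Finset.mem_range.mpr hs)⟩

/-- The update that merges components according to the two-colouring that merges most. -/
noncomputable def mergeUpdate (S : ℕ) (h : ℕ → ℤ → Bool) (x : Tok) (v : ℕ → ℤ) : Tok :=
  ![x 0, x 1, x 2, if x.hooks (h (pickMax S v)) then x 4 else x 3, 0, 0]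

/-! ### The two selections made in a round. -/

section Round

variable {N : ℕ} {X K : ℤ} {x : Fin N → Tok} {selA selB : Fin N → Fin N}

/-- Sharing no node costs at least `X ^ 2`, more than a squared distance of labels can gain; the
token itself is an admissible choice of priority zero. -/
lemma Tok.IsBest.res_eq_zero (hNX : N ≤ X) (hx : Tok.Valid X x) (hKX : K ≤ X)
    (hlab : ∀ i, 0 ≤ x i 3 ∧ x i 3 < K)
    (hA : Tok.IsBest X (fun _ => 0) (-1) (X ^ 2) x selA) (i : Fin N) :
    (x i).res (x (selA i)) = 0 := by
  have h := hA.prio_le hNX hx i i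
  simp only [Tok.prio, Tok.res_self] at h
  by_contra hne
  have h1 : 1 ≤ (x i).res (x (selA i)) ^ 2 := by
    have := sq_pos_of_ne_zero hne; omega
  have h2 := hlab i
  have h3 := hlab (selA i)
  have h4 : (x i 3 - x (selA i) 3) ^ 2 < X ^ 2 := by
    apply sq_lt_sq'  <;> omega
  nlinarith

lemma Tok.IsBest.farthest (hNX : N ≤ X) (hx : Tok.Valid X x) (hKX : K ≤ X)
    (hlab : ∀ i, 0 ≤ x i 3 ∧ x i 3 < K)
    (hA : Tok.IsBest X (fun _ => 0) (-1) (X ^ 2) x selA) {i j : Fin N}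
    (hij : (x i).res (x j) = 0) (hne : x j 3 ≠ x i 3) : x (selA i) 3 ≠ x i 3 := by
  have h := hA.prio_le hNX hx i j
  have h0 := Tok.IsBest.res_eq_zero hNX hx hKX hlab hA i
  simp only [Tok.prio, hij, h0] at h
  intro he
  rw [he] at h
  have : 0 < (x i 3 - x j 3) ^ 2 := sq_pos_of_ne_zero (by omega)
  nlinarith

/-- The token itself has priority at least 0, while a different label costs at least 2 and the
indicator gains at most 1. -/
lemma Tok.IsBest.label_eq
    (hB : Tok.IsBest X (fun y => if y 3 ≠ y 4 then 1 else 0) 2 0 x selB)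
    (hNX : N ≤ X) (hx : Tok.Valid X x) (i : Fin N) :
    x (selB i) 3 = x i 3 := by
  have h := hB.prio_le hNX hx i i
  simp only [Tok.prio] at h
  by_contra hne
  have : 1 ≤ (x i 3 - x (selB i) 3) ^ 2 := by
    have : 0 < (x i 3 - x (selB i) 3) ^ 2 := sq_pos_of_ne_zero (by omega)
    omega
  split_ifs at h <;> linarith

/-- The priority depends on the query only through its label, and ties are broken alike for all
queries. So all tokens of a component agree on one leader. -/
lemma Tok.IsBest.congr
    (hB : Tok.IsBest X (fun y => if y 3 ≠ y 4 then 1 else 0) 2 0 x selB)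
    (hNX : N ≤ X) (hx : Tok.Valid X x) {i j : Fin N} (hij : x i 3 = x j 3) :
    selB i = selB j := by
  have h1 := hB i (selB j)
  have h2 := hB j (selB i)
  simp only [Tok.prio, hij, zero_mul] at h1 h2
  exact Tok.eq_of_prio_eq hNX hx (le_antisymm h2 h1)

lemma Tok.IsBest.active
    (hB : Tok.IsBest X (fun y => if y 3 ≠ y 4 then 1 else 0) 2 0 x selB)
    (hNX : N ≤ X) (hx : Tok.Valid X x) {i j : Fin N} (hij : x i 3 = x j 3)
    (hj : x j 3 ≠ x j 4) : x (selB i) 3 ≠ x (selB i) 4 := by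
  have h := hB.prio_le hNX hx i j
  have h1 := Tok.IsBest.label_eq hB hNX hx i
  simp only [Tok.prio, hij, if_pos hj] at h
  by_contra hne
  rw [if_neg (not_not.mpr hne), h1, hij] at h
  simp at h

end Round

/-- One round of three layers: the number of active labels drops by a sixteenth. -/
lemma exists_round {l p m t K : ℕ} (hl : 2 ≤ l) (hp : p = 100 * l) (hm : 40 ≤ m)
    (ht : 0 < t) (hmt : 16 * t + 6 ≤ m) (hKt : K ≤ 2 ^ t) (hKl : K ≤ 2 ^ l) :
    ∃ Ls : List (TransformerLayer p m 1), Ls.length = 3 ∧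
      ∀ (N : ℕ) (x : Fin N → Tok), (N : ℤ) ≤ 2 ^ l → Tok.Valid (2 ^ l) x →
        (∀ i, 0 ≤ x i 3 ∧ x i 3 < K) →
        ∃ x' : Fin N → Tok, runLayers Ls (fun i => Tok.enc p m (x i)) =
            (fun i => Tok.enc p m (x' i)) ∧
          Tok.Valid (2 ^ l) x' ∧ (∀ i, 0 ≤ x' i 3 ∧ x' i 3 < K) ∧
          (∀ i, x' i 0 = x i 0 ∧ x' i 1 = x i 1) ∧
          (∀ i j, x i 3 = x j 3 → x' i 3 = x' j 3) ∧
          (∀ E : Fin N → Fin N → Prop, Equivalence E →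
            (∀ i j, (x i).res (x j) = 0 → E i j) → (∀ i j, x i 3 = x j 3 → E i j) →
            ∀ i j, x' i 3 = x' j 3 → E i j) ∧
          16 * (activeLabels x').card ≤ 15 * (activeLabels x).card := by
  classical
  obtain ⟨h, hh⟩ := exists_separating_family hKt
  set X : ℤ := 2 ^ l with hX
  have hX4 : 4 ≤ X := by
    calc (4 : ℤ) = 2 ^ 2 := by norm_num
      _ ≤ 2 ^ l := pow_le_pow_right₀ (by norm_num) hl
  have hKX : (K : ℤ) ≤ X := by rw [hX]; exact_mod_cast hKl
  have hX5 : (4 : ℤ) ≤ X ^ 5 := hX4.trans (le_self_pow₀ (by omega) (by norm_num))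
  obtain ⟨LA, hLA⟩ := exists_prioLayer hl hp hm (fun _ => 0) (-1) (X ^ 2) meetUpdate
    (fun y _ => by rw [← hX]; simp; omega) (by rw [← hX]; simp; omega) (by
      rw [← hX, abs_of_nonneg (by positivity)]
      exact pow_le_pow_right₀ (by omega) (by norm_num))
  obtain ⟨LB, hLB⟩ := exists_prioLayer hl hp hm (fun y => if y 3 ≠ y 4 then 1 else 0) 2 0
    leadUpdate (fun y _ => by rw [← hX]; split_ifs <;> simp <;> omega)
    (by rw [← hX]; simp; omega) (by rw [← hX]; simp; omega)
  -- Every token proposes a label that it meets, every component adopts the proposal of its leader,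
  -- and the mergers are counted at the leaders, once per component and colouring.
  refine ⟨[LA, LB, countLayer p m (fun y s => decide (y 5 = 1) && y.hooks (h s))
    (mergeUpdate (16 * t) h)], rfl, fun N x hN hx hlab => ?_⟩
  rw [← hX] at hLA hLB
  have hXX : X ≤ X ^ 2 := le_self_pow₀ (by omega) (by norm_num)
  have habs : ∀ z : ℤ, 0 ≤ z → z < K → |z| ≤ X ^ 2 := fun z h0 h1 => by
    rw [abs_of_nonneg h0]; omega
  obtain ⟨selA, hselA, hrunA⟩ := hLA N x hN hx
  set x₁ : Fin N → Tok := fun i => meetUpdate (x i) (x (selA i)) with hx₁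
  have hv₁ : Tok.Valid X x₁ := by
    refine ⟨fun i c => ?_, fun i => hx.pos i⟩
    have := habs _ (hlab (selA i)).1 (hlab (selA i)).2
    have h0 := hx.bound i
    fin_cases c
    · exact h0 0
    · exact h0 1
    · exact h0 2
    · exact h0 3
    · exact this
    · exact (abs_zero).trans_le (by positivity)
  obtain ⟨selB, hselB, hrunB⟩ := hLB N x₁ hN hv₁
  set x₂ : Fin N → Tok := fun i => leadUpdate (x₁ i) (x₁ (selB i)) with hx₂
  have h13 : ∀ i, x₁ i 3 = x i 3 := fun i => rfl
  have h14 : ∀ i, x₁ i 4 = x (selA i) 3 := fun i => rfl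
  have h23 : ∀ i, x₂ i 3 = x i 3 := fun i => rfl
  have h24 : ∀ i, x₂ i 4 = x (selA (selB i)) 3 := fun i => rfl
  have hv₂ : Tok.Valid X x₂ := by
    refine ⟨fun i c => ?_, fun i => hx.pos i⟩
    have := habs _ (hlab (selA (selB i))).1 (hlab (selA (selB i))).2
    have h0 := hx.bound i
    fin_cases c
    · exact h0 0
    · exact h0 1
    · exact h0 2
    · exact h0 3
    · exact this
    · change |(if x₁ (selB i) 2 = x₁ i 2 then (1 : ℤ) else 0)| ≤ X ^ 2
      split_ifs
      · rw [abs_one]; omega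
      · rw [abs_zero]; omega
  have hself : ∀ i, x (selB i) 3 = x i 3 := fun i => Tok.IsBest.label_eq hselB hN hv₁ i
  have hcongr : ∀ i j, x i 3 = x j 3 → selB i = selB j := fun i j hij =>
    Tok.IsBest.congr hselB hN hv₁ hij
  have hmeet : ∀ i, (x i).res (x (selA i)) = 0 := fun i =>
    Tok.IsBest.res_eq_zero hN hx hKX hlab hselA i
  have hact : ∀ i j, (x i).res (x j) = 0 → x j 3 ≠ x i 3 → x₂ i 4 ≠ x i 3 := by
    intro i j hij hne
    have h1 := Tok.IsBest.farthest hN hx hKX hlab hselA hij hne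
    have h2 := Tok.IsBest.active hselB hN hv₁ (i := i) (j := i) rfl h1.symm
    rw [h13, h14, hself] at h2
    exact h2.symm
  have hrep : ∀ i, x₂ i 5 = 1 ↔ selB i = i := by
    intro i
    change (if x (selB i) 2 = x i 2 then (1 : ℤ) else 0) = 1 ↔ _
    rw [hx.pos, hx.pos]
    constructor
    · intro hi
      by_contra hne
      rw [if_neg] at hi
      · exact zero_ne_one hi
      · intro he; exact hne (Fin.ext (by exact_mod_cast he))
    · intro hi; rw [hi, if_pos rfl]
  have hN2 : ∀ i c, |x₂ i c| ≤ 4 ^ p := by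
    intro i c
    refine (hv₂.bound i c).trans ?_
    calc X ^ 2 = 2 ^ (l * 2) := by rw [hX, ← pow_mul]
      _ ≤ 2 ^ (2 * p) := pow_le_pow_right₀ (by norm_num) (by omega)
      _ = 4 ^ p := by rw [pow_mul]; norm_num
  rcases Nat.eq_zero_or_pos N with hN0 | hN0
  · subst hN0
    refine ⟨x, ?_, hx, hlab, fun i => i.elim0, fun i => i.elim0, fun _ _ _ _ i => i.elim0, ?_⟩
    · funext i; exact i.elim0
    · have : activeLabels x = ∅ := by
        ext a; rw [mem_activeLabels]; simp
      simp [this]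
  have hNp : N ≤ 2 ^ p := by
    have : (N : ℤ) ≤ 2 ^ p := hN.trans (pow_le_pow_right₀ (by norm_num) (by omega))
    exact_mod_cast this
  obtain ⟨w, hw, hrunC⟩ := countLayer_apply (m := m) (by omega) hN0 hNp
    (fun y s => decide (y 5 = 1) && y.hooks (h s)) (mergeUpdate (16 * t) h) x₂ hN2
  set v : ℕ → ℤ := fun c => if 6 + c < m then w * (Finset.univ.filter fun j =>
    (decide (x₂ j 5 = 1) && (x₂ j).hooks (h c)) = true).card else 0 with hv
  set σ := pickMax (16 * t) v with hσ
  obtain ⟨hσ1, hσ2⟩ := pickMax_spec (S := 16 * t) (by omega) v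
  set x₃ : Fin N → Tok := fun i => mergeUpdate (16 * t) h (x₂ i) v with hx₃
  have h33 : ∀ i, x₃ i 3 = if (x₂ i).hooks (h σ) then x₂ i 4 else x i 3 := fun i => rfl
  have hfun : ∀ i j, x i 3 = x j 3 → x₂ i 4 = x₂ j 4 := fun i j hij => by
    rw [h24, h24, hcongr i j hij]
  have hhook : ∀ i j, x i 3 = x j 3 → (x₂ i).hooks (h σ) = (x₂ j).hooks (h σ) :=
    fun i j hij => by
      simp only [Tok.hooks, h23, hij, hfun i j hij]
  have hlab₃ : ∀ i, 0 ≤ x₃ i 3 ∧ x₃ i 3 < K := by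
    intro i
    rw [h33]
    split_ifs
    · exact hlab _
    · exact hlab _
  have hfun₃ : ∀ i j, x i 3 = x j 3 → x₃ i 3 = x₃ j 3 := fun i j hij => by
    rw [h33, h33, hhook i j hij, hfun i j hij, hij]
  refine ⟨x₃, ?_, ⟨fun i c => ?_, fun i => hx.pos i⟩, hlab₃, fun i => ⟨rfl, rfl⟩, hfun₃, ?_, ?_⟩
  · rw [runLayers_cons, runLayers_cons, runLayers_cons, runLayers_nil, hrunA, hrunB, hrunC]
  · have := habs _ (hlab₃ i).1 (hlab₃ i).2
    have h0 := hx.bound i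
    fin_cases c
    · exact h0 0
    · exact h0 1
    · exact h0 2
    · exact this
    · exact (abs_zero).trans_le (by positivity)
    · exact (abs_zero).trans_le (by positivity)
  · intro E hE hmE hlE
    -- The new label of a token was the old label of an equivalent token: either the token itself,
    -- or the one that its leader met.
    have key : ∀ i, ∃ j, x j 3 = x₃ i 3 ∧ E i j := by
      intro i
      rw [h33]
      split_ifs
      · exact ⟨selA (selB i), rfl, hE.trans (hlE _ _ (hself i).symm) (hmE _ _ (hmeet _))⟩
      · exact ⟨i, rfl, hE.refl i⟩
    intro i j hij
    obtain ⟨i', hi', hEi⟩ := key i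
    obtain ⟨j', hj', hEj⟩ := key j
    exact hE.trans hEi (hE.trans (hlE _ _ (by rw [hi', hj', hij])) (hE.symm hEj))
  -- `RA` consists of the leaders with a genuine proposal, one for each active label; `Hk s` are
  -- those among them that colouring `s` would merge away.
  · set RA := Finset.univ.filter fun i => selB i = i ∧ x₂ i 4 ≠ x i 3 with hRA
    set Hk : ℕ → Finset (Fin N) := fun s => RA.filter fun i => (x₂ i).hooks (h s) = true with hHk
    have hrepmem : ∀ i, x₂ i 4 ≠ x i 3 → selB i ∈ RA := by
      intro i hi
      have h1 := hcongr _ _ (hself i)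
      simp only [hRA, Finset.mem_filter, Finset.mem_univ, true_and]
      refine ⟨h1, ?_⟩
      rw [hself, hfun _ _ (hself i)]
      exact hi
    have hinj : Set.InjOn (fun i => x i 3) RA := by
      intro i hi j hj hij
      simp only [hRA, Finset.coe_filter, Finset.mem_univ, true_and, Set.mem_ofPred_eq] at hi hj
      rw [← hi.1, ← hj.1]
      exact hcongr i j hij
    have hadj : ∀ i, x₂ i 4 ≠ x i 3 → x i 3 ∈ activeLabels x := by
      intro i hi
      rw [mem_activeLabels]
      refine ⟨selB i, selA (selB i), hmeet _, ?_, hself i⟩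
      rw [hself]; exact hi
    have hcard : (activeLabels x).card = RA.card := by
      rw [← Finset.card_image_of_injOn hinj]
      congr 1
      ext a
      rw [Finset.mem_image]
      constructor
      · intro ha
        obtain ⟨i, j, hij, hne, rfl⟩ := mem_activeLabels.mp ha
        exact ⟨selB i, hrepmem i (hact i j hij hne), hself i⟩
      · rintro ⟨i, hi, rfl⟩
        simp only [hRA, Finset.mem_filter, Finset.mem_univ, true_and] at hi
        exact hadj i hi.2
    -- Every label still active was active before and was not merged away. If the token hooked, its
    -- new label is that of the target, which was active because it meets the hooking component, and
    -- which has colour `false` and so does not hook. Otherwise the label is unchanged, and the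
    -- differing neighbour already differed before.
    have hsub : activeLabels x₃ ⊆ (RA \ Hk σ).image fun i => x i 3 := by
      intro a ha
      obtain ⟨i, j, hij, hne, rfl⟩ := mem_activeLabels.mp ha
      have hij' : (x i).res (x j) = 0 := hij
      by_cases hi : (x₂ i).hooks (h σ) = true
      · set j' := selA (selB i) with hj'
        have hne' : x₂ i 4 ≠ x i 3 := by
          intro he
          simp only [Tok.hooks, h23, he] at hi
          simp at hi
        have hj4 : x₂ j' 4 ≠ x j' 3 := by
          refine hact j' (selB i) (Tok.res_comm_zero (hmeet _)) ?_
          rw [hself]; exact hne'.symm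
        rw [Finset.mem_image]
        refine ⟨selB j', Finset.mem_sdiff.mpr ⟨hrepmem j' hj4, ?_⟩, ?_⟩
        · intro hmem
          have h1 := (Finset.mem_filter.mp hmem).2
          rw [hhook _ _ (hself j')] at h1
          simp only [Tok.hooks, h23, h24, Bool.and_eq_true, Bool.not_eq_true'] at h1 hi
          rw [← hj'] at hi
          simp [hi.2] at h1
        · rw [h33, if_pos hi, hself]; rfl
      · have hlne : x j 3 ≠ x i 3 := fun he => hne (hfun₃ _ _ he)
        rw [Finset.mem_image]
        refine ⟨selB i, Finset.mem_sdiff.mpr ⟨hrepmem i (hact i j hij' hlne), ?_⟩, ?_⟩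
        · intro hmem
          have h1 := (Finset.mem_filter.mp hmem).2
          rw [hhook _ _ (hself i)] at h1
          exact hi h1
        · rw [h33, if_neg hi, hself]
    -- The bound `16 * t + 6 ≤ m` provides a coordinate for each colouring. Hooking forces two
    -- different labels, so counting all hooking leaders counts members of `RA` only.
    have hcnt : ∀ s < 16 * t, v s = w * (Hk s).card := by
      intro s hs
      simp only [hv]
      rw [if_pos (by omega)]
      congr 3
      ext i
      simp only [hHk, hRA, Finset.mem_filter, Finset.mem_univ, true_and, Bool.and_eq_true,
        decide_eq_true_eq, hrep]
      constructor
      · rintro ⟨h1, h2⟩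
        refine ⟨⟨h1, fun he => ?_⟩, h2⟩
        simp only [Tok.hooks, h23, he] at h2
        simp at h2
      · rintro ⟨⟨h1, -⟩, h2⟩; exact ⟨h1, h2⟩
    have hmax : ∀ s < 16 * t, (Hk s).card ≤ (Hk σ).card := by
      intro s hs
      have h1 := hσ2 s hs
      rw [hcnt s hs, hcnt _ hσ1] at h1
      have h2 := le_of_mul_le_mul_left h1 hw
      exact_mod_cast h2
    -- Double counting: each leader in `RA` hooks under at least `t` of the `16 * t` colourings, and
    -- none of these hooks more leaders than `σ`.
    have hdouble : t * RA.card ≤ 16 * t * (Hk σ).card := by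
      calc t * RA.card = ∑ _i ∈ RA, t := by simp [mul_comm]
        _ ≤ ∑ i ∈ RA, ((Finset.range (16 * t)).filter fun s =>
              (x₂ i).hooks (h s) = true).card := by
            refine Finset.sum_le_sum fun i hi => ?_
            simp only [hRA, Finset.mem_filter, Finset.mem_univ, true_and] at hi
            have := hh (x i 3) (x₂ i 4) (hlab i).1 (hlab i).2 (hlab _).1 (hlab _).2 hi.2.symm
            refine this.trans (le_of_eq ?_)
            congr 1
            refine Finset.filter_congr fun s _ => ?_
            simp [Tok.hooks, h23]
        _ = ∑ s ∈ Finset.range (16 * t), (Hk s).card := by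
            simp only [hHk, Finset.card_filter]
            exact Finset.sum_comm
        _ ≤ ∑ _s ∈ Finset.range (16 * t), (Hk σ).card :=
            Finset.sum_le_sum fun s hs => hmax s (Finset.mem_range.mp hs)
        _ = 16 * t * (Hk σ).card := by simp
    have hdouble' : RA.card ≤ 16 * (Hk σ).card := by
      have : t * RA.card ≤ t * (16 * (Hk σ).card) := by linarith
      exact Nat.le_of_mul_le_mul_left this ht
    have h1 : (activeLabels x₃).card ≤ RA.card - (Hk σ).card := by
      refine (Finset.card_le_card hsub).trans (Finset.card_image_le.trans ?_)
      rw [Finset.card_sdiff_of_subset (Finset.filter_subset _ _)]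
    have h2 : (Hk σ).card ≤ RA.card := Finset.card_le_card (Finset.filter_subset _ _)
    rw [hcard]
    omega

/-! ## The transformer layers -/

lemma Tok.res_congr {x y x' y' : Tok} (hx0 : x' 0 = x 0) (hx1 : x' 1 = x 1) (hy0 : y' 0 = y 0)
    (hy1 : y' 1 = y 1) : x'.res y' = x.res y := by
  simp [Tok.res, hx0, hx1, hy0, hy1]

/-- Several rounds: the number of active labels drops exponentially. -/
lemma exists_rounds {l p m t K : ℕ} (hl : 2 ≤ l) (hp : p = 100 * l) (hm : 40 ≤ m)
    (ht : 0 < t) (hmt : 16 * t + 6 ≤ m) (hKt : K ≤ 2 ^ t) (hKl : K ≤ 2 ^ l) (R : ℕ) :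
    ∃ Ls : List (TransformerLayer p m 1), Ls.length = 3 * R ∧
      ∀ (N : ℕ) (x : Fin N → Tok), (N : ℤ) ≤ 2 ^ l → Tok.Valid (2 ^ l) x →
        (∀ i, 0 ≤ x i 3 ∧ x i 3 < K) →
        ∃ x' : Fin N → Tok, runLayers Ls (fun i => Tok.enc p m (x i)) =
            (fun i => Tok.enc p m (x' i)) ∧
          Tok.Valid (2 ^ l) x' ∧ (∀ i, 0 ≤ x' i 3 ∧ x' i 3 < K) ∧
          (∀ i, x' i 0 = x i 0 ∧ x' i 1 = x i 1) ∧
          (∀ i j, x i 3 = x j 3 → x' i 3 = x' j 3) ∧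
          (∀ E : Fin N → Fin N → Prop, Equivalence E →
            (∀ i j, (x i).res (x j) = 0 → E i j) → (∀ i j, x i 3 = x j 3 → E i j) →
            ∀ i j, x' i 3 = x' j 3 → E i j) ∧
          16 ^ R * (activeLabels x').card ≤ 15 ^ R * (activeLabels x).card := by
  induction R with
  | zero =>
    exact ⟨[], rfl, fun N x _ hx hlab => ⟨x, rfl, hx, hlab, fun i => ⟨rfl, rfl⟩,
      fun _ _ h => h, fun _ _ _ h => h, by simp⟩⟩
  | succ R ih =>
    obtain ⟨L, hLl, hL⟩ := ih
    obtain ⟨L', hLl', hL'⟩ := exists_round hl hp hm ht hmt hKt hKl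
    refine ⟨L ++ L', by rw [List.length_append, hLl, hLl']; ring, fun N x hN hx hlab => ?_⟩
    obtain ⟨y, hrun, hy, hylab, hyn, hyf, hyE, hyc⟩ := hL N x hN hx hlab
    obtain ⟨z, hrun', hz, hzlab, hzn, hzf, hzE, hzc⟩ := hL' N y hN hy hylab
    refine ⟨z, by rw [runLayers_append, hrun, hrun'], hz, hzlab, fun i => ?_,
      fun i j h => hzf i j (hyf i j h), fun E hE hm hl => ?_, ?_⟩
    · rw [(hzn i).1, (hzn i).2]; exact hyn i
    · refine hzE E hE (fun i j hij => hm i j ?_) (hyE E hE hm hl)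
      rwa [Tok.res_congr (hyn i).1 (hyn i).2 (hyn j).1 (hyn j).2] at hij
    · rw [pow_succ, pow_succ]
      nlinarith [Nat.zero_le (activeLabels z).card, Nat.zero_le (16 ^ R)]

/-- The update that replaces a token by another one unless they carry the same label. -/
def copyUpdate (x y : Tok) : Tok :=
  if y 3 = x 3 then ![x 0, x 1, x 2, x 3, 0, 0] else ![y 0, y 1, x 2, y 3, 0, 0]

/-- One layer replaces the tokens whose label is carried by no flagged token. -/
lemma exists_copyLayer {l p m K : ℕ} (hl : 2 ≤ l) (hp : p = 100 * l) (hm : 40 ≤ m)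
    (hKl : K ≤ 2 ^ l) :
    ∃ L : TransformerLayer p m 1,
      ∀ (N : ℕ) (x : Fin N → Tok), (N : ℤ) ≤ 2 ^ l → Tok.Valid (2 ^ l) x →
        (∀ i, 0 ≤ x i 3 ∧ x i 3 < K) → (∀ i, x i 4 = 0 ∨ x i 4 = 1) → (∃ i, x i 4 = 1) →
        ∃ (x' : Fin N → Tok) (τ : Fin N → Fin N),
          L.apply (fun i => Tok.enc p m (x i)) = (fun i => Tok.enc p m (x' i)) ∧
          Tok.Valid (2 ^ l) x' ∧
          (∀ i, x' i 0 = x (τ i) 0 ∧ x' i 1 = x (τ i) 1 ∧ x' i 3 = x (τ i) 3) ∧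
          (∀ i, ∃ j, x j 4 = 1 ∧ x j 3 = x (τ i) 3) ∧
          (∀ i, (∃ j, x j 4 = 1 ∧ x j 3 = x i 3) → τ i = i) := by
  set X : ℤ := 2 ^ l with hX
  have hX4 : 4 ≤ X := by
    calc (4 : ℤ) = 2 ^ 2 := by norm_num
      _ ≤ 2 ^ l := pow_le_pow_right₀ (by norm_num) hl
  have hKX : (K : ℤ) ≤ X := by rw [hX]; exact_mod_cast hKl
  have hX5 : (4 : ℤ) ≤ X ^ 5 := hX4.trans (le_self_pow₀ (by omega) (by norm_num))
  -- Squared label distances stay below `X ^ 2`, so a flagged token always wins, and among these the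
  -- one with the nearest label: the own label, if it is flagged anywhere. Tokens of discarded
  -- blocks thus become duplicates of tokens in good blocks.
  obtain ⟨L, hL⟩ := exists_prioLayer hl hp hm (fun y => X ^ 2 * y 4) 1 0 copyUpdate
    (fun y hy => by
      rw [← hX] at hy ⊢
      exact abs_le_pow_of_le (by omega) (abs_mul_le_pow (i := 2) (j := 2)
        (by rw [abs_of_nonneg (by positivity)]) (hy 4)) (by norm_num))
    (by rw [← hX, abs_one]; omega) (by rw [← hX, abs_zero]; omega)
  rw [← hX] at hL
  refine ⟨L, fun N x hN hx hlab hflag hex => ?_⟩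
  obtain ⟨sel, hsel, hrun⟩ := hL N x hN hx
  have hle := hsel.prio_le hN hx
  simp only [Tok.prio, zero_mul, sub_zero, one_mul] at hle
  have hdiff : ∀ i j, (x i 3 - x j 3) ^ 2 < X ^ 2 := fun i j => by
    have h2 := hlab i
    have h3 := hlab j
    apply sq_lt_sq' <;> omega
  have hsel1 : ∀ i, x (sel i) 4 = 1 := by
    intro i
    obtain ⟨j, hj⟩ := hex
    have h1 := hle i j
    have h2 := hdiff i j
    rcases hflag (sel i) with h | h
    · rw [h, hj] at h1
      have := sq_nonneg (x i 3 - x (sel i) 3)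
      linarith
    · exact h
  refine ⟨_, fun i => if x (sel i) 3 = x i 3 then i else sel i, hrun, ⟨fun i c => ?_, fun i => ?_⟩,
    fun i => ?_, fun i => ⟨sel i, hsel1 i, ?_⟩, ?_⟩
  · have h0 := hx.bound i
    have h1 := hx.bound (sel i)
    have h2 : |(0 : ℤ)| ≤ X ^ 2 := (abs_zero).trans_le (by positivity)
    unfold copyUpdate
    split_ifs <;> fin_cases c
    · exact h0 0
    · exact h0 1
    · exact h0 2
    · exact h0 3
    · exact h2
    · exact h2
    · exact h1 0
    · exact h1 1
    · exact h0 2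
    · exact h1 3
    · exact h2
    · exact h2
  · unfold copyUpdate
    split_ifs <;> exact hx.pos i
  · unfold copyUpdate
    by_cases h : x (sel i) 3 = x i 3
    · simp [h]
    · simp [h]
  · dsimp only
    split_ifs with h
    · exact h
    · rfl
  · rintro i ⟨j, hj, hji⟩
    have h1 := hle i j
    rw [hj, hsel1, hji] at h1
    have h2 : (x i 3 - x (sel i) 3) ^ 2 = 0 := by
      have := sq_nonneg (x i 3 - x (sel i) 3)
      nlinarith
    have h3 : x i 3 - x (sel i) 3 = 0 := by simpa using h2
    exact if_pos (by omega)

/-- One layer compares the label of every token with the farthest label. -/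
lemma exists_compareLayer {l p m : ℕ} (hl : 2 ≤ l) (hp : p = 100 * l) (hm : 40 ≤ m) :
    ∃ L : TransformerLayer p m 1,
      ∀ (N : ℕ) (x : Fin N → Tok), (N : ℤ) ≤ 2 ^ l → Tok.Valid (2 ^ l) x →
        ∃ x' : Fin N → Tok, L.apply (fun i => Tok.enc p m (x i)) =
            (fun i => Tok.enc p m (x' i)) ∧ (∀ i c, |x' i c| ≤ ((2 : ℤ) ^ l) ^ 2) ∧
          ∀ i, x' i 3 = x' i 4 ↔ ∀ j, x j 3 = x i 3 := by
  set X : ℤ := 2 ^ l with hX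
  have hX4 : 4 ≤ X := by
    calc (4 : ℤ) = 2 ^ 2 := by norm_num
      _ ≤ 2 ^ l := pow_le_pow_right₀ (by norm_num) hl
  have hX5 : (4 : ℤ) ≤ X ^ 5 := hX4.trans (le_self_pow₀ (by omega) (by norm_num))
  obtain ⟨L, hL⟩ := exists_prioLayer hl hp hm (fun _ => 0) (-1) 0 meetUpdate
    (fun y _ => by rw [← hX, abs_zero]; omega) (by rw [← hX, abs_neg, abs_one]; omega)
    (by rw [← hX, abs_zero]; omega)
  rw [← hX] at hL
  refine ⟨L, fun N x hN hx => ?_⟩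
  obtain ⟨sel, hsel, hrun⟩ := hL N x hN hx
  refine ⟨_, hrun, fun i c => ?_, fun i => ?_⟩
  · have h0 := hx.bound i
    fin_cases c
    · exact h0 0
    · exact h0 1
    · exact h0 2
    · exact h0 3
    · exact hx.bound (sel i) 3
    · exact (abs_zero).trans_le (by positivity)
  · change x i 3 = x (sel i) 3 ↔ _
    constructor
    · intro h j
      have h1 := hsel.prio_le hN hx i j
      simp only [Tok.prio, zero_mul, sub_zero] at h1
      rw [h] at h1 ⊢
      have h2 : (x (sel i) 3 - x j 3) ^ 2 = 0 := by
        have := sq_nonneg (x (sel i) 3 - x j 3)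
        nlinarith
      have h3 : x (sel i) 3 - x j 3 = 0 := by simpa using h2
      omega
    · intro h; exact (h _).symm

lemma card_activeLabels_le {N K : ℕ} {x : Fin N → Tok} (hlab : ∀ i, 0 ≤ x i 3 ∧ x i 3 < K) :
    (activeLabels x).card ≤ K := by
  have hsub : activeLabels x ⊆ Finset.Ico (0 : ℤ) K := by
    intro a ha
    obtain ⟨i, j, -, -, rfl⟩ := mem_activeLabels.mp ha
    exact Finset.mem_Ico.mpr (hlab i)
  simpa using Finset.card_le_card hsub

/-- The whole stack of layers decides whether all tokens with flagged labels are equivalent under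
the relation generated by sharing a node and by carrying the same label. -/
lemma exists_connectivity_layers {l p m t K R : ℕ} (hl : 2 ≤ l) (hp : p = 100 * l) (hm : 40 ≤ m)
    (ht : 0 < t) (hmt : 16 * t + 6 ≤ m) (hKt : K ≤ 2 ^ t) (hKl : K ≤ 2 ^ l)
    (hR : 15 ^ R * K < 16 ^ R) :
    ∃ Ls : List (TransformerLayer p m 1), Ls.length = 3 * R + 2 ∧
      ∀ (N : ℕ) (x : Fin N → Tok), (N : ℤ) ≤ 2 ^ l → Tok.Valid (2 ^ l) x →
        (∀ i, 0 ≤ x i 3 ∧ x i 3 < K) → (∀ i, x i 4 = 0 ∨ x i 4 = 1) → (∃ i, x i 4 = 1) →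
        ∃ (x' : Fin N → Tok) (τ : Fin N → Fin N) (c : Fin N → ℤ),
          runLayers Ls (fun i => Tok.enc p m (x i)) = (fun i => Tok.enc p m (x' i)) ∧
          (∀ i a, |x' i a| ≤ 4 ^ p) ∧
          (∀ i, x' i 3 = x' i 4 ↔ ∀ j, c j = c i) ∧
          (∀ i, ∃ j, x j 4 = 1 ∧ x j 3 = x (τ i) 3) ∧
          (∀ i, (∃ j, x j 4 = 1 ∧ x j 3 = x i 3) → τ i = i) ∧
          (∀ i j, (x (τ i)).res (x (τ j)) = 0 → c i = c j) ∧
          (∀ i j, x (τ i) 3 = x (τ j) 3 → c i = c j) ∧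
          (∀ E : Fin N → Fin N → Prop, Equivalence E →
            (∀ i j, (x (τ i)).res (x (τ j)) = 0 → E i j) →
            (∀ i j, x (τ i) 3 = x (τ j) 3 → E i j) → ∀ i j, c i = c j → E i j) := by
  obtain ⟨L₁, h₁⟩ := exists_copyLayer hl hp hm hKl
  obtain ⟨L₂, hlen, h₂⟩ := exists_rounds hl hp hm ht hmt hKt hKl R
  obtain ⟨L₃, h₃⟩ := exists_compareLayer hl hp hm
  refine ⟨L₁ :: (L₂ ++ [L₃]), by simp [hlen], fun N x hN hx hlab hflag hex => ?_⟩
  obtain ⟨y, τ, hrun₁, hy, hyn, hτ, hτ'⟩ := h₁ N x hN hx hlab hflag hex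
  have hylab : ∀ i, 0 ≤ y i 3 ∧ y i 3 < K := fun i => by
    rw [(hyn i).2.2]; exact hlab _
  obtain ⟨z, hrun₂, hz, hzlab, hzn, hzf, hzE, hzc⟩ := h₂ N y hN hy hylab
  obtain ⟨x', hrun₃, hxb, hx'⟩ := h₃ N z hN hz
  have hres : ∀ i j, (x (τ i)).res (x (τ j)) = (y i).res (y j) := fun i j =>
    (Tok.res_congr (hyn i).1 (hyn i).2.1 (hyn j).1 (hyn j).2.1).symm
  refine ⟨x', τ, fun i => z i 3, ?_, fun i a => ?_, hx', hτ, hτ', fun i j hij => ?_,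
    fun i j hij => ?_, fun E hE hm hl => ?_⟩
  · rw [runLayers_cons, runLayers_append, hrun₁, hrun₂, runLayers_cons, runLayers_nil, hrun₃]
  · refine (hxb i a).trans ?_
    calc ((2 : ℤ) ^ l) ^ 2 = 2 ^ (l * 2) := by rw [← pow_mul]
      _ ≤ 2 ^ (2 * p) := pow_le_pow_right₀ (by norm_num) (by omega)
      _ = 4 ^ p := by rw [pow_mul]; norm_num
  -- There are at most `K` active labels initially, so by `hR` fewer than one survives `R` rounds.
  · have hempty : activeLabels z = ∅ := by
      rw [← Finset.card_eq_zero]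
      by_contra hne
      have h1 : 1 ≤ (activeLabels z).card := Nat.one_le_iff_ne_zero.mpr hne
      have h2 : 15 ^ R * (activeLabels y).card ≤ 15 ^ R * K :=
        Nat.mul_le_mul_left _ (card_activeLabels_le hylab)
      have h3 : 16 ^ R ≤ 16 ^ R * (activeLabels z).card := Nat.le_mul_of_pos_right _ h1
      omega
    by_contra hne
    have : z i 3 ∈ activeLabels z := by
      rw [mem_activeLabels]
      refine ⟨i, j, ?_, fun he => hne he.symm, rfl⟩
      rw [Tok.res_congr (hzn i).1 (hzn i).2 (hzn j).1 (hzn j).2, ← hres]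
      exact hij
    rw [hempty] at this
    exact absurd this (Finset.notMem_empty _)
  · apply hzf
    rw [(hyn i).2.2, (hyn j).2.2]; exact hij
  · refine hzE E hE (fun i j hij => hm i j ?_) (fun i j hij => hl i j ?_)
    · rw [hres]; exact hij
    · rw [← (hyn i).2.2, ← (hyn j).2.2]; exact hij

/-! ## Components of a prefix of a sequence -/

section LastLink

open Classical in
/-- After `T` positions have been read, the last position in the component of `i`, where
positions are linked by the relation `S`. -/
noncomputable def lastLink (S : ℕ → ℕ → Prop) : ℕ → ℕ → ℕ
  | 0, i => i
  | T + 1, i => if i = T then T else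
      if ∃ i' < T, S T i' ∧ lastLink S T i' = lastLink S T i then T else lastLink S T i

variable {S : ℕ → ℕ → Prop}

lemma lastLink_succ_self (T : ℕ) : lastLink S (T + 1) T = T := by
  simp [lastLink]

open Classical in
lemma lastLink_succ_of_lt {T i : ℕ} (hi : i < T) : lastLink S (T + 1) i =
    if ∃ i' < T, S T i' ∧ lastLink S T i' = lastLink S T i then T else lastLink S T i := by
  simp [lastLink, hi.ne]

lemma le_lastLink {T i : ℕ} (hi : i < T) : i ≤ lastLink S T i ∧ lastLink S T i < T := by
  induction T with
  | zero => omega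
  | succ T ih =>
    rcases Nat.lt_succ_iff_lt_or_eq.mp hi with h | h
    · rw [lastLink_succ_of_lt h]
      have := ih h
      split_ifs <;> omega
    · subst h; rw [lastLink_succ_self]; omega

/-- Components therefore correspond to fixed points of `lastLink S T`, which is how `HasClosed`
detects them. -/
lemma lastLink_lastLink {T i : ℕ} (hi : i < T) :
    lastLink S T (lastLink S T i) = lastLink S T i := by
  induction T with
  | zero => omega
  | succ T ih =>
    rcases Nat.lt_succ_iff_lt_or_eq.mp hi with h | h
    · have h1 := lastLink_succ_of_lt (S := S) h
      by_cases hc : ∃ i' < T, S T i' ∧ lastLink S T i' = lastLink S T i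
      · rw [if_pos hc] at h1
        rw [h1, lastLink_succ_self]
      · rw [if_neg hc] at h1
        rw [h1, lastLink_succ_of_lt (le_lastLink h).2, ih h, if_neg hc]
    · subst h; rw [lastLink_succ_self, lastLink_succ_self]

/-- Soundness of the labels: they identify no more than the equivalence generated by `S`.
Completeness is `lastLink_eq_of_rel`. -/
lemma lastLink_rel {E : ℕ → ℕ → Prop} (hE : Equivalence E) (hS : ∀ i j, S i j → E i j)
    {T i : ℕ} (hi : i < T) : E i (lastLink S T i) := by
  induction T generalizing i with
  | zero => omega
  | succ T ih =>
    rcases Nat.lt_succ_iff_lt_or_eq.mp hi with h | h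
    · rw [lastLink_succ_of_lt h]
      split_ifs with hc
      · obtain ⟨i', hi', hS', he⟩ := hc
        have h1 := ih hi'
        rw [he] at h1
        exact hE.trans (ih h) (hE.trans (hE.symm h1) (hE.symm (hS _ _ hS')))
      · exact ih h
    · subst h; rw [lastLink_succ_self]; exact hE.refl i

lemma lastLink_succ_congr {T i j : ℕ} (hi : i < T) (hj : j < T)
    (h : lastLink S T i = lastLink S T j) : lastLink S (T + 1) i = lastLink S (T + 1) j := by
  rw [lastLink_succ_of_lt hi, lastLink_succ_of_lt hj, h]

lemma lastLink_eq_of_rel {T i j : ℕ} (hj : j < i) (hi : i < T) (h : S i j) :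
    lastLink S T i = lastLink S T j := by
  induction T with
  | zero => omega
  | succ T ih =>
    rcases Nat.lt_succ_iff_lt_or_eq.mp hi with h' | h'
    · exact lastLink_succ_congr h' (hj.trans h') (ih h')
    · subst h'
      rw [lastLink_succ_self, lastLink_succ_of_lt hj, if_pos ⟨j, hj, h, rfl⟩]

/-- After `T` positions, some component of the block of the last position
lies more than `k` positions back. -/
def HasClosed (S : ℕ → ℕ → Prop) (k n' T : ℕ) : Prop :=
  ∃ i, i + k + 1 < T ∧ i / n' = (T - 1) / n' ∧ lastLink S T i = i

lemma not_hasClosed_zero (k n' : ℕ) : ¬ HasClosed S k n' 0 := by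
  rintro ⟨i, hi, -⟩; omega

lemma div_pred_eq_of_mod_ne {T n' : ℕ} (h : T % n' ≠ 0) : (T - 1) / n' = T / n' := by
  obtain ⟨T, rfl⟩ : ∃ T', T = T' + 1 := ⟨T - 1, by
    rcases T with _ | T
    · simp at h
    · simp⟩
  rw [Nat.add_sub_cancel, Nat.succ_div, if_neg]
  · simp
  · intro hd; exact h (Nat.mod_eq_zero_of_dvd hd)

lemma mod_ne_zero_of_div_eq {T n' i : ℕ} (hi : i < T) (h : i / n' = T / n') :
    T % n' ≠ 0 := by
  intro h0
  have h1 := Nat.div_add_mod T n'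
  rw [h0, ← h] at h1
  have h2 := Nat.div_mul_le_self i n'
  rw [mul_comm] at h2
  omega

/-- The new position is linked only to positions from `T - k` on, so closed components stay closed
while the block lasts, and only a component ending at `T - 1 - k` can become closed now. The flag is
dropped when `T` starts a block. -/
lemma hasClosed_succ {k n' T : ℕ} (hloc : ∀ i < T, S T i → T ≤ i + k) :
    HasClosed S k n' (T + 1) ↔ (T % n' ≠ 0 ∧ HasClosed S k n' T) ∨
      (k + 1 ≤ T ∧ (T - 1 - k) / n' = T / n' ∧ lastLink S (T + 1) (T - 1 - k) = T - 1 - k) := by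
  -- If `T` absorbs the component of `i`, that component contains some `i' ≥ T - k`, so `i` was not
  -- its last position before either.
  have key : ∀ i, i + k + 1 < T → (lastLink S (T + 1) i = i ↔ lastLink S T i = i) := by
    intro i hi
    rw [lastLink_succ_of_lt (by omega)]
    split_ifs with hc
    · obtain ⟨i', hi', hS', he⟩ := hc
      have h1 := hloc i' hi' hS'
      have h2 := (le_lastLink (S := S) hi').1
      constructor
      · intro h; omega
      · intro h; omega
    · rfl
  constructor
  · rintro ⟨i, hi, hb, hl⟩
    rw [Nat.add_sub_cancel] at hb
    rcases Nat.lt_or_ge (i + k + 1) T with h | h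
    · left
      have h0 := mod_ne_zero_of_div_eq (by omega) hb
      exact ⟨h0, i, h, by rw [hb, div_pred_eq_of_mod_ne h0], (key i h).mp hl⟩
    · right
      obtain rfl : i = T - 1 - k := by omega
      exact ⟨by omega, hb, hl⟩
  · rintro (⟨h0, i, hi, hb, hl⟩ | ⟨hk, hb, hl⟩)
    · exact ⟨i, by omega, by rw [hb, div_pred_eq_of_mod_ne h0, Nat.add_sub_cancel],
        (key i hi).mpr hl⟩
    · exact ⟨T - 1 - k, by omega, by rw [hb, Nat.add_sub_cancel], hl⟩

/-- A component of the block other than that of `T` has a last position `r < T`. Either `r` lies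
more than `k` back, and the component is closed, or `r` is in the window and shows the label `r`
there. -/
lemma block_joined_iff {k n' T : ℕ} (hSb : ∀ i j, S i j → i / n' = j / n') :
    (¬ HasClosed S k n' (T + 1) ∧ ∀ s : Fin (k + 1), (s : ℕ) ≤ T → (T - s) / n' = T / n' →
      lastLink S (T + 1) (T - s) = T) ↔
    ∀ i ≤ T, i / n' = T / n' → lastLink S (T + 1) i = T := by
  constructor
  · rintro ⟨h1, h2⟩ i hi hb
    set r := lastLink S (T + 1) i with hr
    have hrT := (le_lastLink (S := S) (Nat.lt_succ_of_le hi)).2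
    rw [← hr] at hrT
    have hrr : lastLink S (T + 1) r = r := lastLink_lastLink (Nat.lt_succ_of_le hi)
    have hrb : r / n' = T / n' := by
      rw [← hb]
      exact (lastLink_rel (E := fun a b => a / n' = b / n') ⟨fun _ => rfl, fun h => h.symm,
        fun h h' => h.trans h'⟩ hSb (Nat.lt_succ_of_le hi)).symm
    by_contra hne
    rcases Nat.lt_or_ge (r + k) T with h | h
    · exact h1 ⟨r, by omega, by rw [Nat.add_sub_cancel]; exact hrb, hrr⟩
    · have h3 := h2 ⟨T - r, by omega⟩ (by simp) (by
        simp only; rw [Nat.sub_sub_self (by omega)]; exact hrb)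
      simp only at h3
      rw [Nat.sub_sub_self (by omega), hrr] at h3
      exact hne h3
  · intro h
    refine ⟨?_, fun s hs hb => h _ (Nat.sub_le _ _) hb⟩
    rintro ⟨i, hi, hb, hl⟩
    rw [Nat.add_sub_cancel] at hb
    have := h i (by omega) hb
    omega

end LastLink

/-! ## The recurrent layer -/

/-- The places of the hidden state: the position, the flag of a closed component, and a window
of `k + 1` edges with their component labels. -/
abbrev HidIdx (k : ℕ) : Type := Fin 2 ⊕ (Fin (k + 1) × Fin 3)

/-- Two edges, each given by two numbers, share a node. -/
def EdgesMeet (u w u' w' : ℤ) : Prop := (u = u' ∨ u = w') ∨ (w = u' ∨ w = w')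

/-- The label of the new edge's component is given to the edges labelled `c`. -/
def HidMatched {k : ℕ} (n' : ℕ) (u w : ℤ) (v : HidIdx k → ℤ) (c : ℤ) : Prop :=
  ∃ s : Fin (k + 1), (s : ℕ) + 1 ≤ (v (Sum.inl 0)).toNat ∧
    ((v (Sum.inl 0)).toNat - 1 - s) / n' = (v (Sum.inl 0)).toNat / n' ∧
    EdgesMeet u w (v (Sum.inr (s, 0))) (v (Sum.inr (s, 1))) ∧ v (Sum.inr (s, 2)) = c

open Classical in
/-- The new component label in slot `s` of the old window. -/
noncomputable def hidLabel {k : ℕ} (n' : ℕ) (u w : ℤ) (v : HidIdx k → ℤ) (s : Fin (k + 1)) : ℤ :=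
  if HidMatched n' u w v (v (Sum.inr (s, 2))) then v (Sum.inl 0) else v (Sum.inr (s, 2))

/-- The flag of a closed component after the new edge. -/
def HidClosed {k : ℕ} (n' : ℕ) (u w : ℤ) (v : HidIdx k → ℤ) : Prop :=
  ((v (Sum.inl 0)).toNat % n' ≠ 0 ∧ v (Sum.inl 1) = 1) ∨
    (k + 1 ≤ (v (Sum.inl 0)).toNat ∧
      ((v (Sum.inl 0)).toNat - 1 - k) / n' = (v (Sum.inl 0)).toNat / n' ∧
      hidLabel n' u w v (Fin.last k) = ((v (Sum.inl 0)).toNat - 1 - k : ℕ))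

open Classical in
/-- The hidden state after the new edge. -/
noncomputable def hidStep {k : ℕ} (n' : ℕ) (u w : ℤ) (v : HidIdx k → ℤ) : HidIdx k → ℤ
  | Sum.inl i => ![v (Sum.inl 0) + 1, if HidClosed n' u w v then 1 else 0] i
  | Sum.inr (s, c) => Fin.cases (motive := fun _ => ℤ) (![u, w, v (Sum.inl 0)] c)
      (fun s' => if (s' : ℕ) + 1 ≤ (v (Sum.inl 0)).toNat then
        ![v (Sum.inr (s'.castSucc, 0)), v (Sum.inr (s'.castSucc, 1)),
          hidLabel n' u w v s'.castSucc] c else 0) s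

open Classical in
/-- The state of the token after the recurrent layer: the nodes of the edge, its position, its
block, and a flag at the end of blocks whose edges form one component. -/
noncomputable def hidOut {k : ℕ} (n' : ℕ) (u w : ℤ) (v : HidIdx k → ℤ) : Tok :=
  ![u, w, v (Sum.inl 0), ((v (Sum.inl 0)).toNat / n' : ℕ),
    if ((v (Sum.inl 0)).toNat + 1) % n' = 0 ∧ ¬ HidClosed n' u w v ∧
      ∀ s : Fin (k + 1), (s : ℕ) ≤ (v (Sum.inl 0)).toNat →
        ((v (Sum.inl 0)).toNat - s) / n' = (v (Sum.inl 0)).toNat / n' →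
        hidStep n' u w v (Sum.inr (s, 2)) = v (Sum.inl 0)
    then 1 else 0, 0]

open Classical in
/-- The hidden state after `T` edges, described through the components of the prefix. -/
noncomputable def hidState (k n' : ℕ) (S : ℕ → ℕ → Prop) (U W : ℕ → ℤ) (T : ℕ) : HidIdx k → ℤ
  | Sum.inl i => ![(T : ℤ), if HasClosed S k n' T then 1 else 0] i
  | Sum.inr (s, c) => if (s : ℕ) + 1 ≤ T then
      ![U (T - 1 - s), W (T - 1 - s), (lastLink S T (T - 1 - s) : ℤ)] c else 0

/-! ### The recurrence follows the components of the prefix. -/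

section Correct

variable {k n' N : ℕ} {S : ℕ → ℕ → Prop} {U W : ℕ → ℤ}

/-- By locality every earlier edge that meets the new one is still in the window, so searching the
window is enough. -/
lemma hidMatched_iff {T : ℕ} (hT : T < N) (hloc : ∀ i < T, S T i → T ≤ i + k)
    (hS : ∀ i j, i < N → j < N →
      (S i j ↔ i / n' = j / n' ∧ EdgesMeet (U i) (W i) (U j) (W j))) (i : ℕ) :
    HidMatched n' (U T) (W T) (hidState k n' S U W T) (lastLink S T i) ↔
      ∃ i' < T, S T i' ∧ lastLink S T i' = lastLink S T i := by
  constructor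
  · rintro ⟨s, h1, h2, h3, h4⟩
    simp only [hidState, Matrix.cons_val_zero, Int.toNat_natCast] at h1 h2 h3 h4
    rw [if_pos h1] at h3 h4
    rw [if_pos h1] at h3
    refine ⟨T - 1 - s, by omega, (hS _ _ hT (by omega)).mpr ⟨h2.symm, h3⟩, ?_⟩
    exact Nat.cast_injective (R := ℤ) h4
  · rintro ⟨i', hi', hS', he⟩
    have h1 := hloc i' hi' hS'
    have h2 := (hS _ _ hT (by omega)).mp hS'
    have h3 : T - 1 - (T - 1 - i') = i' := by omega
    have h4 : T - 1 - i' + 1 ≤ T := by omega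
    refine ⟨⟨T - 1 - i', by omega⟩, ?_, ?_, ?_, ?_⟩ <;>
      simp only [hidState, Matrix.cons_val_zero, Int.toNat_natCast, h3, if_pos h4]
    · exact h4
    · exact h2.1.symm
    · exact h2.2
    · exact congrArg (Nat.cast (R := ℤ)) he

lemma hidLabel_eq {T : ℕ} (hT : T < N) (hloc : ∀ i < T, S T i → T ≤ i + k)
    (hS : ∀ i j, i < N → j < N →
      (S i j ↔ i / n' = j / n' ∧ EdgesMeet (U i) (W i) (U j) (W j))) (s : Fin (k + 1))
    (hs : (s : ℕ) + 1 ≤ T) :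
    hidLabel n' (U T) (W T) (hidState k n' S U W T) s = lastLink S (T + 1) (T - 1 - s) := by
  have h1 : hidState k n' S U W T (Sum.inr (s, 2)) = lastLink S T (T - 1 - s) := by
    simp only [hidState, if_pos hs]
    rfl
  have h2 := hidMatched_iff hT hloc hS (T - 1 - s)
  rw [lastLink_succ_of_lt (by omega), hidLabel, h1]
  by_cases h : HidMatched n' (U T) (W T) (hidState k n' S U W T) (lastLink S T (T - 1 - s))
  · rw [if_pos h, if_pos (h2.mp h)]; simp [hidState]
  · rw [if_neg h, if_neg (fun h' => h (h2.mpr h'))]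

lemma hidClosed_iff {T : ℕ} (hT : T < N) (hloc : ∀ i < T, S T i → T ≤ i + k)
    (hS : ∀ i j, i < N → j < N →
      (S i j ↔ i / n' = j / n' ∧ EdgesMeet (U i) (W i) (U j) (W j))) :
    HidClosed n' (U T) (W T) (hidState k n' S U W T) ↔ HasClosed S k n' (T + 1) := by
  have h0 : hidState k n' S U W T (Sum.inl 0) = T := by simp [hidState]
  have h1 : hidState k n' S U W T (Sum.inl 1) = 1 ↔ HasClosed S k n' T := by
    simp [hidState]
  rw [hasClosed_succ hloc, HidClosed, h0, h1, Int.toNat_natCast]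
  refine or_congr Iff.rfl (and_congr_right fun hk => and_congr_right fun _ => ?_)
  rw [hidLabel_eq hT hloc hS _ (by simpa using hk)]
  simp only [Fin.val_last]
  exact_mod_cast Iff.rfl

lemma hidStep_hidState {T : ℕ} (hT : T < N)
    (hloc : ∀ i < T, S T i → T ≤ i + k)
    (hS : ∀ i j, i < N → j < N →
      (S i j ↔ i / n' = j / n' ∧ EdgesMeet (U i) (W i) (U j) (W j))) :
    hidStep n' (U T) (W T) (hidState k n' S U W T) = hidState k n' S U W (T + 1) := by
  have h0 : hidState k n' S U W T (Sum.inl 0) = T := by simp [hidState]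
  funext q
  rcases q with i | ⟨s, c⟩
  · fin_cases i
    · simp [hidStep, hidState]
    · simp only [hidStep]
      rw [hidClosed_iff hT hloc hS]
      simp [hidState]
  · induction s using Fin.cases with
    | zero =>
      simp only [hidStep, Fin.cases_zero, h0]
      fin_cases c <;> simp [hidState, lastLink_succ_self]
    | succ s =>
      simp only [hidStep, Fin.cases_succ, h0, Int.toNat_natCast]
      have h2 : T - (s + 1) = T - 1 - s := by omega
      by_cases hs : (s : ℕ) + 1 ≤ T
      · rw [if_pos hs, hidLabel_eq hT hloc hS _ (by simpa using hs)]
        fin_cases c <;> simp [hidState, hs, h2]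
      · rw [if_neg hs]
        simp [hidState, hs]

lemma hidOut_hidState {T : ℕ} (hT : T < N)
    (hloc : ∀ i < T, S T i → T ≤ i + k)
    (hS : ∀ i j, i < N → j < N →
      (S i j ↔ i / n' = j / n' ∧ EdgesMeet (U i) (W i) (U j) (W j)))
    (hSb : ∀ i j, S i j → i / n' = j / n') :
    ∃ f : ℤ, hidOut n' (U T) (W T) (hidState k n' S U W T) =
        ![U T, W T, (T : ℤ), (T / n' : ℕ), f, 0] ∧ (f = 0 ∨ f = 1) ∧
      (f = 1 ↔ (T + 1) % n' = 0 ∧ ∀ i ≤ T, i / n' = T / n' → lastLink S (T + 1) i = T) := by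
  have h0 : hidState k n' S U W T (Sum.inl 0) = T := by simp [hidState]
  have h1 : ∀ s : Fin (k + 1), (s : ℕ) ≤ T → (hidState k n' S U W (T + 1) (Sum.inr (s, 2)) = T ↔
      lastLink S (T + 1) (T - s) = T) := by
    intro s hs
    have : (s : ℕ) + 1 ≤ T + 1 := by omega
    simp [hidState, hs]
  rw [hidOut, hidStep_hidState hT hloc hS, h0, Int.toNat_natCast]
  refine ⟨_, rfl, ?_, ?_⟩
  · split_ifs
    · exact Or.inr rfl
    · exact Or.inl rfl
  · have hite : ∀ (P : Prop) [Decidable P], (if P then (1 : ℤ) else 0) = 1 ↔ P := by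
      intro P _; simp
    rw [hite, ← block_joined_iff (k := k) hSb, ← hidClosed_iff hT hloc hS]
    refine and_congr_right fun _ => and_congr_right fun _ => forall_congr' fun s =>
      forall_congr' fun hs => imp_congr_right fun _ => h1 s hs

end Correct

/-- Two edges of a sequence lie in the same block of length `n'` and share a node. -/
def BlockMeet {M N : ℕ} (n' : ℕ) (e : Fin N → Sym2 (Fin M)) (s t : Fin N) : Prop :=
  (s : ℕ) / n' = (t : ℕ) / n' ∧ ∃ v, v ∈ e s ∧ v ∈ e t

/-- The edges of the block of position `i` form a single component. -/
def GoodBlock {M N : ℕ} (n' : ℕ) (e : Fin N → Sym2 (Fin M)) (i : Fin N) : Prop :=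
  ∀ E : Fin N → Fin N → Prop, Equivalence E → (∀ s t, BlockMeet n' e s t → E s t) →
    ∀ s t : Fin N, (s : ℕ) / n' = (i : ℕ) / n' → (t : ℕ) / n' = (i : ℕ) / n' → E s t

lemma Sym2.mem_iff_inf_sup {M : ℕ} (z : Sym2 (Fin M)) (v : Fin M) :
    v ∈ z ↔ v = z.inf ∨ v = z.sup := by
  induction z with
  | _ a b =>
    rw [Sym2.mem_iff, Sym2.inf_mk, Sym2.sup_mk]
    rcases le_total a b with h | h
    · rw [inf_eq_left.mpr h, sup_eq_right.mpr h]
    · rw [inf_eq_right.mpr h, sup_eq_left.mpr h, or_comm]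

lemma edgesMeet_iff {M : ℕ} (z z' : Sym2 (Fin M)) :
    EdgesMeet ((z.inf : Fin M) : ℕ) ((z.sup : Fin M) : ℕ) ((z'.inf : Fin M) : ℕ)
      ((z'.sup : Fin M) : ℕ) ↔ ∃ v, v ∈ z ∧ v ∈ z' := by
  simp only [Sym2.mem_iff_inf_sup, EdgesMeet, Nat.cast_inj, Fin.val_inj]
  constructor
  · rintro ((h | h) | (h | h))
    · exact ⟨z.inf, Or.inl rfl, Or.inl h⟩
    · exact ⟨z.inf, Or.inl rfl, Or.inr h⟩
    · exact ⟨z.sup, Or.inr rfl, Or.inl h⟩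
    · exact ⟨z.sup, Or.inr rfl, Or.inr h⟩
  · rintro ⟨v, rfl | rfl, h | h⟩ <;> simp [h]

/-- The places of the hidden state, numbered. -/
def hidEquiv (k : ℕ) : HidIdx k ≃ Fin (2 + (k + 1) * 3) :=
  (Equiv.sumCongr (Equiv.refl _) finProdFinEquiv).trans finSumFinEquiv

/-- The hidden state as a vector of fixed-point numbers. -/
def hidEnc (p k : ℕ) (v : HidIdx k → ℤ) : FVec p (2 + (k + 1) * 3) :=
  fun c => Fixed.clamp p (v ((hidEquiv k).symm c))

/-- The hidden state, read off its vector. -/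
def hidDec {p k : ℕ} (y : FVec p (2 + (k + 1) * 3)) : HidIdx k → ℤ :=
  fun q => (y (hidEquiv k q) : ℤ)

lemma hidDec_hidEnc {p k : ℕ} {v : HidIdx k → ℤ} (hv : ∀ q, |v q| ≤ 4 ^ p) :
    hidDec (hidEnc p k v) = v := by
  funext q
  simp only [hidDec, hidEnc, Equiv.symm_apply_apply]
  exact Fixed.coe_clamp (hv q)

/-- The recurrent layer that follows the components within the blocks of length `n'`. -/
noncomputable def componentRNN (p k n' m : ℕ) : RNNLayer p 2 (2 + (k + 1) * 3) m where
  init := hidEnc p k fun _ => 0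
  step x y := (Tok.enc p m (hidOut n' ((x 0 : ℤ) / 2 ^ p) ((x 1 : ℤ) / 2 ^ p) (hidDec y)),
    hidEnc p k (hidStep n' ((x 0 : ℤ) / 2 ^ p) ((x 1 : ℤ) / 2 ^ p) (hidDec y)))

lemma coe_ofReal_natCast_div {p a : ℕ} (ha : a ≤ 2 ^ p) :
    ((Fixed.ofReal p (a : ℝ) : Fixed p) : ℤ) / 2 ^ p = a := by
  have h : |(a : ℤ)| ≤ 2 ^ p := by
    rw [abs_of_nonneg (by positivity)]; exact_mod_cast ha
  have h1 := Fixed.ofReal_intCast p a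
  rw [Int.cast_natCast] at h1
  rw [h1, Fixed.coe_clamp (Fixed.abs_mul_two_pow_le h)]
  exact Int.mul_ediv_cancel _ (by positivity)

lemma componentRNN_apply {p k n' m N M : ℕ} (e : Fin N → Sym2 (Fin M)) (hM : M ≤ 2 ^ p)
    (hN : N ≤ 2 ^ p)
    (hloc : ∀ s t : Fin N, BlockMeet n' e s t → (t : ℕ) ≤ s + k) :
    ∃ x : Fin N → Tok,
      (componentRNN p k n' m).apply (fun t => edgeToken p (e t)) = (fun i => Tok.enc p m (x i)) ∧
      ∀ i, (x i 0 = ((e i).inf : Fin M) ∧ x i 1 = ((e i).sup : Fin M)) ∧ x i 2 = (i : ℕ) ∧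
        x i 3 = ((i : ℕ) / n' : ℕ) ∧ x i 5 = 0 ∧ (x i 4 = 0 ∨ x i 4 = 1) ∧
        (x i 4 = 1 ↔ ((i : ℕ) + 1) % n' = 0 ∧ GoodBlock n' e i) := by
  classical
  set U : ℕ → ℤ := fun i => if h : i < N then (((e ⟨i, h⟩).inf : Fin M) : ℕ) else 0 with hU
  set W : ℕ → ℤ := fun i => if h : i < N then (((e ⟨i, h⟩).sup : Fin M) : ℕ) else 0 with hW
  set S : ℕ → ℕ → Prop := fun i j => ∃ (hi : i < N) (hj : j < N),
    BlockMeet n' e ⟨i, hi⟩ ⟨j, hj⟩ with hSdef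
  have hSb : ∀ i j, S i j → i / n' = j / n' := fun i j ⟨_, _, h⟩ => h.1
  have hSsymm : ∀ i j, S i j → S j i := fun i j ⟨hi, hj, h, v, h1, h2⟩ =>
    ⟨hj, hi, h.symm, v, h2, h1⟩
  have hS : ∀ i j, i < N → j < N →
      (S i j ↔ i / n' = j / n' ∧ EdgesMeet (U i) (W i) (U j) (W j)) := by
    intro i j hi hj
    simp only [hU, hW, dif_pos hi, dif_pos hj, edgesMeet_iff]
    exact ⟨fun ⟨_, _, h⟩ => h, fun h => ⟨hi, hj, h⟩⟩
  have hlocS : ∀ T, ∀ i < T, S T i → T ≤ i + k := by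
    intro T i _ h
    obtain ⟨hi, hT, h⟩ := hSsymm _ _ h
    exact hloc _ _ h
  have h4 : (2 : ℤ) ^ p ≤ 4 ^ p := pow_le_pow_left₀ (by norm_num) (by norm_num) p
  have hcast : ∀ a : ℕ, a ≤ 2 ^ p → |(a : ℤ)| ≤ 4 ^ p := by
    intro a ha
    rw [abs_of_nonneg (by positivity)]
    exact le_trans (by exact_mod_cast ha) h4
  have hUb : ∀ i, |U i| ≤ 4 ^ p := by
    intro i
    simp only [hU]
    split_ifs
    · exact hcast _ ((Fin.is_lt _).le.trans hM)
    · simp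
  have hWb : ∀ i, |W i| ≤ 4 ^ p := by
    intro i
    simp only [hW]
    split_ifs
    · exact hcast _ ((Fin.is_lt _).le.trans hM)
    · simp
  have hbound : ∀ T ≤ N, ∀ q, |hidState k n' S U W T q| ≤ 4 ^ p := by
    intro T hT q
    rcases q with i | ⟨s, c⟩
    · fin_cases i
      · exact hcast T (hT.trans hN)
      · simp only [hidState]
        split_ifs <;> simp [one_le_pow₀]
    · simp only [hidState]
      split_ifs with hs
      · fin_cases c
        · exact hUb _
        · exact hWb _
        · have := (le_lastLink (S := S) (T := T) (i := T - 1 - s) (by omega)).2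
          exact hcast _ (by omega)
      · simp
  have htok : ∀ T (hT : T < N), ((edgeToken p (e ⟨T, hT⟩) 0 : Fixed p) : ℤ) / 2 ^ p = U T ∧
      ((edgeToken p (e ⟨T, hT⟩) 1 : Fixed p) : ℤ) / 2 ^ p = W T := by
    intro T hT
    simp only [hU, hW, dif_pos hT]
    exact ⟨coe_ofReal_natCast_div ((Fin.is_lt _).le.trans hM),
      coe_ofReal_natCast_div ((Fin.is_lt _).le.trans hM)⟩
  have hhid : ∀ T ≤ N, (componentRNN p k n' m).hidden (fun t => edgeToken p (e t)) T =
      hidEnc p k (hidState k n' S U W T) := by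
    intro T
    induction T with
    | zero =>
      intro _
      simp only [RNNLayer.hidden, componentRNN]
      congr 1
      funext q
      rcases q with i | ⟨s, c⟩
      · fin_cases i
        · simp [hidState]
        · simp [hidState, not_hasClosed_zero]
      · simp [hidState]
    | succ T ih =>
      intro hT
      have hT' : T < N := hT
      rw [RNNLayer.hidden, dif_pos hT', ih hT'.le]
      simp only [componentRNN]
      rw [(htok T hT').1, (htok T hT').2, hidDec_hidEnc (hbound T hT'.le),
        hidStep_hidState hT' (hlocS T) hS]
  have hout := fun i : Fin N => hidOut_hidState (k := k) i.2 (hlocS i) hS hSb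
  choose f hf hf01 hf1 using hout
  refine ⟨fun i => hidOut n' (U i) (W i) (hidState k n' S U W i), ?_, fun i => ?_⟩
  · funext i
    rw [RNNLayer.apply, hhid _ i.2.le]
    simp only [componentRNN]
    rw [(htok i i.2).1, (htok i i.2).2, hidDec_hidEnc (hbound i i.2.le)]
  · simp only [hf]
    refine ⟨⟨?_, ?_⟩, rfl, rfl, rfl, hf01 i, ?_⟩
    · change U i = _
      simp only [hU, dif_pos i.2]
    · change W i = _
      simp only [hW, dif_pos i.2]
    · change f i = 1 ↔ _
      rw [hf1]
      refine and_congr_right fun hmod => ?_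
      -- Position `i` ends its block, so the prefix up to `i` already contains the whole block.
      have hsep : ∀ a b : ℕ, a ≤ i → (i : ℕ) < b → a / n' ≠ b / n' := by
        intro a b ha hb
        obtain ⟨c, hc⟩ := Nat.dvd_of_mod_eq_zero hmod
        have hn : 0 < n' := by
          rcases Nat.eq_zero_or_pos n' with h | h
          · subst h; simp at hc
          · exact h
        have h1 : a / n' < c := by
          rw [Nat.div_lt_iff_lt_mul hn, mul_comm]; omega
        have h2 : c ≤ b / n' := by
          rw [Nat.le_div_iff_mul_le hn, mul_comm]; omega
        omega
      constructor
      · intro h E hE hES s t hs ht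
        -- `E` is extended from positions to all natural numbers, to match the domain of `lastLink`.
        have hE' : Equivalence fun a b : ℕ => a = b ∨ ∃ (ha : a < N) (hb : b < N),
            E ⟨a, ha⟩ ⟨b, hb⟩ := by
          refine ⟨fun _ => Or.inl rfl, ?_, ?_⟩
          · rintro a b (h | ⟨ha, hb, h⟩)
            · exact Or.inl h.symm
            · exact Or.inr ⟨hb, ha, hE.symm h⟩
          · rintro a b c (rfl | ⟨ha, hb, h⟩) (rfl | ⟨hb', hc, h'⟩)
            · exact Or.inl rfl
            · exact Or.inr ⟨hb', hc, h'⟩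
            · exact Or.inr ⟨ha, hb, h⟩
            · exact Or.inr ⟨ha, hc, hE.trans h h'⟩
        have key : ∀ s : Fin N, (s : ℕ) / n' = (i : ℕ) / n' → E s i := by
          intro s hs
          have hsi : (s : ℕ) ≤ i := by
            by_contra hlt
            exact hsep i s le_rfl (by omega) hs.symm
          have h1 := lastLink_rel (S := S) hE' (fun a b ⟨ha, hb, hab⟩ => Or.inr ⟨ha, hb, hES _ _ hab⟩)
            (Nat.lt_succ_of_le hsi)
          rw [h s hsi hs] at h1
          rcases h1 with h1 | ⟨_, _, h1⟩
          · rw [Fin.ext h1]; exact hE.refl _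
          · exact h1
        exact hE.trans (key s hs) (hE.symm (key t ht))
      · intro h a ha hab
        -- `GoodBlock` is applied to the equivalence "same value of `φ`". Positions after `i` get
        -- one common value; by `hsep` no link crosses from them to the prefix.
        set φ : ℕ → ℕ := fun a => if a ≤ i then lastLink S (i + 1) a else i + 1 with hφ
        have hφS : ∀ a b, S a b → φ a = φ b := by
          intro a b hab
          have hblk := hSb a b hab
          simp only [hφ]
          by_cases ha : a ≤ i <;> by_cases hb : b ≤ i
          · rw [if_pos ha, if_pos hb]
            rcases lt_trichotomy a b with hlt | rfl | hlt
            · exact (lastLink_eq_of_rel hlt (by omega) (hSsymm _ _ hab)).symm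
            · rfl
            · exact lastLink_eq_of_rel hlt (by omega) hab
          · exact absurd hblk (hsep a b ha (by omega))
          · exact absurd hblk.symm (hsep b a hb (by omega))
          · rw [if_neg ha, if_neg hb]
        have haN : a < N := ha.trans_lt i.2
        have h1 := h (fun s t => φ s = φ t) ⟨fun _ => rfl, fun h => h.symm, fun h h' => h.trans h'⟩
          (fun s t hst => hφS _ _ ⟨s.2, t.2, hst⟩) ⟨a, haN⟩ i hab rfl
        simp only [hφ, if_pos ha, le_refl, if_true, lastLink_succ_self] at h1
        exact h1

/-! ## Factored graphs -/

namespace FactoredGraph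

variable {k n n' M : ℕ} {G : SimpleGraph (Fin M)} {e : Fin (n ^ 2 * n') → Sym2 (Fin M)}
  (F : FactoredGraph k n n' G e)

/-- The pair of super-nodes whose super-edge graph contains the edge at a position. -/
def blk (i : Fin (n ^ 2 * n')) : Fin n × Fin n := F.order i.divNat

lemma blk_eq_iff {i j : Fin (n ^ 2 * n')} :
    F.blk i = F.blk j ↔ (i : ℕ) / n' = (j : ℕ) / n' := by
  rw [blk, blk, F.order.injective.eq_iff, Fin.ext_iff, Fin.coe_divNat, Fin.coe_divNat]

lemma edgeBlock_divNat_modNat {α : Type*} {b : ℕ} (f : Fin (b * n') → α) (i : Fin (b * n')) :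
    edgeBlock f i.divNat i.modNat = f i := by
  have h : finProdFinEquiv (i.divNat, i.modNat) = i := finProdFinEquiv.apply_symm_apply i
  rw [edgeBlock, h]

lemma edge_mem (i : Fin (n ^ 2 * n')) : e i ∈ (F.super (F.blk i)).edgeSet := by
  rw [blk, ← F.block_range, ← edgeBlock_divNat_modNat e i]
  exact Set.mem_range_self _

lemma divNat_finProdFinEquiv {b : ℕ} (j : Fin b) (r : Fin n') :
    (finProdFinEquiv (j, r) : Fin (b * n')).divNat = j :=
  congrArg Prod.fst (finProdFinEquiv.symm_apply_apply (j, r))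

lemma exists_pos_of_edge {q : Fin n × Fin n} {z : Sym2 (Fin M)}
    (hz : z ∈ (F.super q).edgeSet) : ∃ i, F.blk i = q ∧ e i = z := by
  obtain ⟨j, rfl⟩ := F.order.surjective q
  rw [← F.block_range] at hz
  obtain ⟨r, hr⟩ := hz
  exact ⟨finProdFinEquiv (j, r), by rw [blk, divNat_finProdFinEquiv], hr⟩

lemma exists_blk_eq (hn' : 1 ≤ n') (q : Fin n × Fin n) : ∃ i, F.blk i = q :=
  ⟨finProdFinEquiv (F.order.symm q, ⟨0, hn'⟩), by
    rw [blk, divNat_finProdFinEquiv, Equiv.apply_symm_apply]⟩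

lemma le_add_of_blockMeet (F : FactoredGraph k n n' G e) {s t : Fin (n ^ 2 * n')} (h : BlockMeet n' e s t) :
    (t : ℕ) ≤ s + k := by
  obtain ⟨h1, v, hs, ht⟩ := h
  have hd : s.divNat = t.divNat := Fin.ext (by rw [Fin.coe_divNat, Fin.coe_divNat, h1])
  rw [← edgeBlock_divNat_modNat e s] at hs
  rw [← edgeBlock_divNat_modNat e t, ← hd] at ht
  have h2 := F.block_local s.divNat v s.modNat t.modNat hs ht
  rw [Fin.coe_modNat, Fin.coe_modNat] at h2
  have h3 := Nat.div_add_mod (s : ℕ) n'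
  have h4 := Nat.div_add_mod (t : ℕ) n'
  rw [h1] at h3
  omega

/-- Two nodes are connected within a super-edge graph. -/
def Joined (q : Fin n × Fin n) (x y : Fin M) : Prop :=
  ∃ (hx : x ∈ (F.super q).verts) (hy : y ∈ (F.super q).verts),
    (F.super q).coe.Reachable ⟨x, hx⟩ ⟨y, hy⟩

variable {F} in
lemma Joined.reachable {q : Fin n × Fin n} {x y : Fin M} (h : F.Joined q x y) :
    G.Reachable x y := by
  obtain ⟨hx, hy, h⟩ := h
  exact h.map (F.super q).hom

variable {F} in
lemma Joined.symm {q : Fin n × Fin n} {x y : Fin M} (h : F.Joined q x y) : F.Joined q y x := by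
  obtain ⟨hx, hy, h⟩ := h
  exact ⟨hy, hx, h.symm⟩

variable {F} in
lemma Joined.tail {q : Fin n × Fin n} {x y z : Fin M} (h : F.Joined q x y)
    (hyz : (F.super q).Adj y z) : F.Joined q x z := by
  obtain ⟨hx, hy, h⟩ := h
  refine ⟨hx, (F.super q).edge_vert hyz.symm, h.trans ?_⟩
  exact SimpleGraph.Adj.reachable (by simpa using hyz)

lemma joined_refl {q : Fin n × Fin n} {x : Fin M} (hx : x ∈ (F.super q).verts) :
    F.Joined q x x := ⟨hx, hx, SimpleGraph.Reachable.refl _⟩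

variable {F} in
lemma Joined.exists_pos {q : Fin n × Fin n} {x y : Fin M} (h : F.Joined q x y) (hne : x ≠ y) :
    ∃ i, F.blk i = q ∧ x ∈ e i := by
  obtain ⟨hx, hy, ⟨w⟩⟩ := h
  cases w with
  | nil => exact absurd rfl hne
  | @cons _ z _ hadj _ =>
    have hz : s(x, (z : Fin M)) ∈ (F.super q).edgeSet := by simpa using hadj
    obtain ⟨i, hi, he⟩ := F.exists_pos_of_edge hz
    exact ⟨i, hi, by rw [he]; exact Sym2.mem_mk_left _ _⟩

variable {F} in
lemma Joined.rel {q : Fin n × Fin n} {x y : Fin M} (h : F.Joined q x y)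
    {E : Fin (n ^ 2 * n') → Fin (n ^ 2 * n') → Prop} (hE : Equivalence E)
    (hEm : ∀ s t, BlockMeet n' e s t → E s t) {s t : Fin (n ^ 2 * n')} (hs : F.blk s = q)
    (ht : F.blk t = q) (hxs : x ∈ e s) (hyt : y ∈ e t) : E s t := by
  obtain ⟨hx, hy, ⟨w⟩⟩ := h
  have key : ∀ (a b : (F.super q).verts) (_ : (F.super q).coe.Walk a b) (s : Fin (n ^ 2 * n')),
      F.blk s = q → (a : Fin M) ∈ e s → (b : Fin M) ∈ e t → E s t := by
    intro a b w
    induction w with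
    | nil =>
      intro s hs ha hb
      exact hEm _ _ ⟨F.blk_eq_iff.mp (hs.trans ht.symm), _, ha, hb⟩
    | @cons a c b hadj _ ih =>
      intro s hs ha hb
      have hz : s((a : Fin M), (c : Fin M)) ∈ (F.super q).edgeSet := by simpa using hadj
      obtain ⟨i, hi, he⟩ := F.exists_pos_of_edge hz
      have h1 : E s i := hEm _ _ ⟨F.blk_eq_iff.mp (hs.trans hi.symm), _, ha, by
        rw [he]; exact Sym2.mem_mk_left _ _⟩
      exact hE.trans h1 (ih i hi (by rw [he]; exact Sym2.mem_mk_right _ _) hb)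
  exact key _ _ w s hs hxs hyt

lemma mem_verts_of_mem_edge {i : Fin (n ^ 2 * n')} {x : Fin M} (hx : x ∈ e i) :
    x ∈ (F.super (F.blk i)).verts :=
  (F.super (F.blk i)).mem_verts_of_mem_edge (F.edge_mem i) hx

/-- The converse fails: if one of two components is a bare end point, all edges lie in the other.
Such a block is good but harmless, as it still does not join two different super-nodes. -/
lemma goodBlock_of_connected {i : Fin (n ^ 2 * n')}
    (h : (F.blk i).1 = (F.blk i).2 ∨ F.kernel.Adj (F.blk i).1 (F.blk i).2) :
    GoodBlock n' e i := by
  intro E hE hEm s t hs ht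
  have hs' := F.blk_eq_iff.mpr hs
  have ht' := F.blk_eq_iff.mpr ht
  have hx := (Sym2.mem_iff_inf_sup (e s) _).mpr (Or.inl rfl)
  have hy := (Sym2.mem_iff_inf_sup (e t) _).mpr (Or.inl rfl)
  have hxv := F.mem_verts_of_mem_edge hx
  have hyv := F.mem_verts_of_mem_edge hy
  rw [hs'] at hxv
  rw [ht'] at hyv
  exact Joined.rel ⟨hxv, hyv, (F.connected _ h).preconnected _ _⟩ hE hEm hs' ht' hx hy

lemma superNode_fst_mem (q : Fin n × Fin n) : F.superNode q.1 ∈ (F.super q).verts := by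
  rw [F.super_verts]; simp

lemma superNode_snd_mem (q : Fin n × Fin n) : F.superNode q.2 ∈ (F.super q).verts := by
  rw [F.super_verts]; simp

lemma eq_of_superNode_mem {q : Fin n × Fin n} {v : Fin n}
    (h : F.superNode v ∈ (F.super q).verts) : v = q.1 ∨ v = q.2 := by
  rw [F.super_verts] at h
  rcases h with h | h
  · rcases h with h | h
    · exact Or.inl (F.superNode.injective h)
    · exact Or.inr (F.superNode.injective h)
  · exact absurd h (F.superNode_notMem_inner v q)

/-- Every node of a super-edge graph is connected there to one of its super-nodes. -/
lemma exists_joined_superNode {q : Fin n × Fin n} {x : Fin M} (hx : x ∈ (F.super q).verts) :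
    ∃ v, F.Joined q (F.superNode v) x := by
  by_cases hq : q.1 = q.2 ∨ F.kernel.Adj q.1 q.2
  · exact ⟨q.1, F.superNode_fst_mem q, hx, (F.connected q hq).preconnected _ _⟩
  · obtain ⟨hcard, hsep⟩ := F.two_components q hq
    set H := (F.super q).coe
    obtain ⟨a, b, hab, huniv⟩ := Nat.card_eq_two_iff.mp hcard
    set c₁ := H.connectedComponentMk ⟨_, F.superNode_fst_mem q⟩ with hc₁
    set c₂ := H.connectedComponentMk ⟨_, F.superNode_snd_mem q⟩ with hc₂
    set c := H.connectedComponentMk ⟨x, hx⟩ with hc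
    have hne : c₁ ≠ c₂ := fun he =>
      hsep _ _ rfl rfl (SimpleGraph.ConnectedComponent.eq.mp he)
    have hall : ∀ d : H.ConnectedComponent, d = a ∨ d = b := fun d => by
      have : d ∈ ({a, b} : Set _) := by rw [huniv]; trivial
      simpa using this
    -- The end points lie in different components, and there are only two components.
    have : c₁ = c ∨ c₂ = c := by
      rcases hall c₁ with h₁ | h₁ <;> rcases hall c₂ with h₂ | h₂ <;>
        rcases hall c with h | h <;> simp_all
    rcases this with h | h
    · exact ⟨q.1, F.superNode_fst_mem q, hx, SimpleGraph.ConnectedComponent.eq.mp h⟩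
    · exact ⟨q.2, F.superNode_snd_mem q, hx, SimpleGraph.ConnectedComponent.eq.mp h⟩

/-- Every super-node has an edge in its own super-edge graph. -/
lemma exists_pos_superNode (hn' : 1 ≤ n') (v : Fin n) :
    ∃ i, F.blk i = (v, v) ∧ F.superNode v ∈ e i := by
  obtain ⟨i, hi⟩ := F.exists_blk_eq hn' (v, v)
  by_cases hv : F.superNode v ∈ e i
  · exact ⟨i, hi, hv⟩
  · have hx := (Sym2.mem_iff_inf_sup (e i) _).mpr (Or.inl rfl)
    have hxv := F.mem_verts_of_mem_edge hx
    rw [hi] at hxv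
    have hne : F.superNode v ≠ (e i).inf := fun he => hv (he ▸ hx)
    exact Joined.exists_pos ⟨F.superNode_fst_mem (v, v), hxv,
      (F.connected (v, v) (Or.inl rfl)).preconnected _ _⟩ hne

lemma exists_mem_verts (x : Fin M) : ∃ q, x ∈ (F.super q).verts := by
  have hx : x ∈ Set.range F.superNode ∪ ⋃ q, F.inner q := by rw [F.verts_cover]; trivial
  rcases hx with ⟨v, rfl⟩ | hx
  · exact ⟨(v, v), F.superNode_fst_mem (v, v)⟩
  · obtain ⟨q, hq⟩ := Set.mem_iUnion.mp hx
    exact ⟨q, by rw [F.super_verts]; exact Or.inr hq⟩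

/-- An inner node is joined within its super-edge graph to a super-node, which is a different node,
so it lies on an edge. The bound lets node labels fit into the precision. -/
lemma card_le (F : FactoredGraph k n n' G e) : M ≤ n + 2 * (n ^ 2 * n') := by
  classical
  have hsub : (Finset.univ : Finset (Fin M)) ⊆ Finset.univ.image F.superNode ∪
      (Finset.univ.image (fun i => (e i).inf) ∪ Finset.univ.image (fun i => (e i).sup)) := by
    intro x _
    have hx : x ∈ Set.range F.superNode ∪ ⋃ q, F.inner q := by rw [F.verts_cover]; trivial
    rcases hx with ⟨v, rfl⟩ | hx
    · exact Finset.mem_union_left _ (Finset.mem_image_of_mem _ (Finset.mem_univ v))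
    · obtain ⟨q, hq⟩ := Set.mem_iUnion.mp hx
      have hxq : x ∈ (F.super q).verts := by rw [F.super_verts]; exact Or.inr hq
      obtain ⟨v, hv⟩ := F.exists_joined_superNode hxq
      have hne : x ≠ F.superNode v := by
        rintro rfl; exact F.superNode_notMem_inner v q hq
      obtain ⟨i, -, hi⟩ := hv.symm.exists_pos hne
      apply Finset.mem_union_right
      rcases (Sym2.mem_iff_inf_sup _ _).mp hi with h | h
      · exact Finset.mem_union_left _ (Finset.mem_image.mpr ⟨i, Finset.mem_univ _, h.symm⟩)
      · exact Finset.mem_union_right _ (Finset.mem_image.mpr ⟨i, Finset.mem_univ _, h.symm⟩)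
  have h1 := Finset.card_le_card hsub
  rw [Finset.card_univ, Fintype.card_fin] at h1
  have h2 := Finset.card_union_le (Finset.univ.image F.superNode)
    (Finset.univ.image (fun i => (e i).inf) ∪ Finset.univ.image (fun i => (e i).sup))
  have h3 := Finset.card_union_le (Finset.univ.image (fun i => (e i).inf))
    (Finset.univ.image (fun i => (e i).sup))
  have h4 : (Finset.univ.image F.superNode).card ≤ n := Finset.card_image_le.trans (by simp)
  have h5 : (Finset.univ.image (fun i => (e i).inf)).card ≤ n ^ 2 * n' :=
    Finset.card_image_le.trans (by simp)
  have h6 : (Finset.univ.image (fun i => (e i).sup)).card ≤ n ^ 2 * n' :=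
    Finset.card_image_le.trans (by simp)
  omega

/-- If all super-nodes are reachable from each other, the graph is connected. -/
lemma connected_of_superNodes (v₀ : Fin n)
    (h : ∀ v v', G.Reachable (F.superNode v) (F.superNode v')) : G.Connected := by
  have key : ∀ x, G.Reachable (F.superNode v₀) x := by
    intro x
    obtain ⟨q, hq⟩ := F.exists_mem_verts x
    obtain ⟨v, hv⟩ := F.exists_joined_superNode hq
    exact (h v₀ v).trans hv.reachable
  have : Nonempty (Fin M) := ⟨F.superNode v₀⟩
  exact ⟨fun x y => (key x).symm.trans (key y)⟩

lemma reachable_of_mem_edge (F : FactoredGraph k n n' G e) {i : Fin (n ^ 2 * n')} {a b : Fin M} (ha : a ∈ e i) (hb : b ∈ e i) :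
    G.Reachable a b := by
  by_cases hab : a = b
  · rw [hab]
  · have he : e i = s(a, b) := (Sym2.mem_and_mem_iff hab).mp ⟨ha, hb⟩
    have h1 := (F.super (F.blk i)).edgeSet_subset (F.edge_mem i)
    rw [he] at h1
    exact SimpleGraph.Adj.reachable h1

/-! ### Labels of good blocks against connectivity of the graph. -/

section Labels

variable {τ : Fin (n ^ 2 * n') → Fin (n ^ 2 * n')} {c : Fin (n ^ 2 * n') → ℤ}

/-- If all labels agree that are finer than the components of the edges of good blocks, the graph
is connected. -/
lemma connected_of_labels (F : FactoredGraph k n n' G e) (hn' : 1 ≤ n') (v₀ : Fin n) (hτ : ∀ i, GoodBlock n' e (τ i))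
    (hτ' : ∀ i, GoodBlock n' e i → τ i = i)
    (hc : ∀ E : Fin (n ^ 2 * n') → Fin (n ^ 2 * n') → Prop, Equivalence E →
      (∀ i j, (∃ v, v ∈ e (τ i) ∧ v ∈ e (τ j)) → E i j) →
      (∀ i j, (τ i : ℕ) / n' = (τ j : ℕ) / n' → E i j) → ∀ i j, c i = c j → E i j)
    (hall : ∀ i j, c i = c j) : G.Connected := by
  -- Reachability between edges is an equivalence that contains sharing of nodes, hence also relates
  -- all edges of a good block. Its pullback along `τ` is fed into `hc`.
  set E₀ : Fin (n ^ 2 * n') → Fin (n ^ 2 * n') → Prop :=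
    fun s t => ∀ a ∈ e s, ∀ b ∈ e t, G.Reachable a b with hE₀
  have hE₀e : Equivalence E₀ := by
    refine ⟨fun s a ha b hb => F.reachable_of_mem_edge ha hb,
      fun h a ha b hb => (h b hb a ha).symm, fun {s t u} h h' a ha b hb => ?_⟩
    have hx := (Sym2.mem_iff_inf_sup (e t) _).mpr (Or.inl rfl)
    exact (h a ha _ hx).trans (h' _ hx b hb)
  have hmeet : ∀ s t, (∃ v, v ∈ e s ∧ v ∈ e t) → E₀ s t := by
    rintro s t ⟨v, hs, ht⟩ a ha b hb
    exact (F.reachable_of_mem_edge ha hs).trans (F.reachable_of_mem_edge ht hb)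
  have hE := hc (fun i j => E₀ (τ i) (τ j)) ⟨fun _ => hE₀e.refl _, fun h => hE₀e.symm h,
    fun h h' => hE₀e.trans h h'⟩ (fun i j h => hmeet _ _ h)
    (fun i j h => hτ i E₀ hE₀e (fun s t hst => hmeet s t hst.2) _ _ rfl h.symm)
  refine F.connected_of_superNodes v₀ fun v v' => ?_
  obtain ⟨i, hi, hvi⟩ := F.exists_pos_superNode hn' v
  obtain ⟨j, hj, hvj⟩ := F.exists_pos_superNode hn' v'
  have h1 := hE i j (hall i j)
  rw [hτ' i (F.goodBlock_of_connected (by rw [hi]; exact Or.inl rfl)),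
    hτ' j (F.goodBlock_of_connected (by rw [hj]; exact Or.inl rfl))] at h1
  exact h1 _ hvi _ hvj

/-- If the graph is connected, all labels agree that are coarser than the components of the edges
of good blocks. -/
lemma labels_eq_of_connected (F : FactoredGraph k n n' G e) (hn' : 1 ≤ n') (hτ : ∀ i, GoodBlock n' e (τ i))
    (hτ' : ∀ i, GoodBlock n' e i → τ i = i)
    (hc₁ : ∀ i j, (∃ v, v ∈ e (τ i) ∧ v ∈ e (τ j)) → c i = c j)
    (hc₂ : ∀ i j, (τ i : ℕ) / n' = (τ j : ℕ) / n' → c i = c j)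
    (hG : G.Connected) (i₀ j₀ : Fin (n ^ 2 * n')) : c j₀ = c i₀ := by
  have hgood : ∀ {i : Fin (n ^ 2 * n')} {v}, F.blk i = (v, v) → τ i = i := fun {i v} hi =>
    hτ' i (F.goodBlock_of_connected (by rw [hi]; exact Or.inl rfl))
  have hshare : ∀ {i j}, τ i = i → τ j = j → ∀ {x}, x ∈ e i → x ∈ e j → c i = c j :=
    fun {i j} hi hj {x} hxi hxj => hc₁ i j ⟨x, by rw [hi]; exact hxi, by rw [hj]; exact hxj⟩
  have hsame : ∀ {i j}, τ i = i → τ j = j → F.blk i = F.blk j → c i = c j :=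
    fun {i j} hi hj hij => hc₂ i j (by rw [hi, hj]; exact F.blk_eq_iff.mp hij)
  have hgoodcongr : ∀ {i j : Fin (n ^ 2 * n')}, F.blk i = F.blk j → GoodBlock n' e i →
      GoodBlock n' e j := by
    intro i j hij hi E hE hEm s t hs ht
    have h1 := F.blk_eq_iff.mp hij
    exact hi E hE hEm s t (hs.trans h1.symm) (ht.trans h1.symm)
  -- Every label already occurs at the block `(v, v)` of some super-node, so it suffices to compare
  -- these blocks.
  have hstart : ∀ i, ∃ v i', F.blk i' = (v, v) ∧ c i' = c i := by
    intro i
    have hx := (Sym2.mem_iff_inf_sup (e (τ i)) _).mpr (Or.inl rfl)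
    obtain ⟨v, hv⟩ := F.exists_joined_superNode (F.mem_verts_of_mem_edge hx)
    obtain ⟨s, hs, hvs⟩ : ∃ s, F.blk s = F.blk (τ i) ∧ F.superNode v ∈ e s := by
      by_cases he : F.superNode v = (e (τ i)).inf
      · exact ⟨τ i, rfl, he ▸ hx⟩
      · exact hv.exists_pos he
    obtain ⟨i', hi', hvi'⟩ := F.exists_pos_superNode hn' v
    have hτs : τ s = s := hτ' s (hgoodcongr hs.symm (hτ i))
    refine ⟨v, i', hi', (hshare (hgood hi') hτs hvi' hvs).trans ?_⟩
    exact hc₂ s i (by rw [hτs]; exact F.blk_eq_iff.mp hs)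
  set Φ : Fin n → Prop := fun v => ∀ i, F.blk i = (v, v) → c i = c i₀ with hΦ
  have hΦ_of : ∀ {v i}, F.blk i = (v, v) → c i = c i₀ → Φ v := fun {v i} hi hci j hj =>
    (hsame (hgood hj) (hgood hi) (hj.trans hi.symm)).trans hci
  -- Different super-nodes joined inside one super-edge graph are its two end points, so the pair is
  -- a kernel edge, its block is good, and the label passes through it.
  have hΦstep : ∀ {q v v'}, Φ v → F.Joined q (F.superNode v) (F.superNode v') → Φ v' := by
    intro q v v' hv hj
    by_cases hvv : v = v'
    · rwa [← hvv]
    have hne : F.superNode v ≠ F.superNode v' := fun he => hvv (F.superNode.injective he)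
    have hq : q.1 = q.2 ∨ F.kernel.Adj q.1 q.2 := by
      by_contra hq
      obtain ⟨-, hsep⟩ := F.two_components q hq
      obtain ⟨h1, h2, hr⟩ := hj
      rcases F.eq_of_superNode_mem h1 with h3 | h3 <;>
        rcases F.eq_of_superNode_mem h2 with h4 | h4
      · exact hvv (h3.trans h4.symm)
      · exact hsep _ _ (congrArg F.superNode h3) (congrArg F.superNode h4) hr
      · exact hsep _ _ (congrArg F.superNode h4) (congrArg F.superNode h3) hr.symm
      · exact hvv (h3.trans h4.symm)
    obtain ⟨s, hs, hvs⟩ := hj.exists_pos hne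
    obtain ⟨t, ht, hvt⟩ := hj.symm.exists_pos hne.symm
    have hτs : τ s = s := hτ' s (F.goodBlock_of_connected (by rw [hs]; exact hq))
    have hτt : τ t = t := hτ' t (F.goodBlock_of_connected (by rw [ht]; exact hq))
    obtain ⟨i, hi, hvi⟩ := F.exists_pos_superNode hn' v
    obtain ⟨j, hj, hvj⟩ := F.exists_pos_superNode hn' v'
    refine hΦ_of hj ?_
    rw [hshare (hgood hj) hτt hvj hvt, hsame hτt hτs (ht.trans hs.symm),
      hshare hτs (hgood hi) hvs hvi]
    exact hv i hi
  set U : Fin M → Prop := fun x => ∃ v q, Φ v ∧ F.Joined q (F.superNode v) x with hU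
  -- A walk can change from one super-edge graph to another only at a super-node, since the sets of
  -- inner nodes are disjoint; there `hΦstep` applies.
  have hUstep : ∀ {x y}, U x → G.Adj x y → U y := by
    rintro x y ⟨v, q, hv, hj⟩ hxy
    have hmem : s(x, y) ∈ ⋃ q, (F.super q).edgeSet := by rw [F.edges_cover]; exact hxy
    obtain ⟨q', hq'⟩ := Set.mem_iUnion.mp hmem
    have hadj : (F.super q').Adj x y := hq'
    have hxq' := (F.super q').edge_vert hadj
    by_cases hx : ∃ v', F.superNode v' = x
    · obtain ⟨v', rfl⟩ := hx
      exact ⟨v', q', hΦstep hv hj, (F.joined_refl hxq').tail hadj⟩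
    · have hinner : ∀ {r}, x ∈ (F.super r).verts → x ∈ F.inner r := by
        intro r hr
        rw [F.super_verts] at hr
        rcases hr with (h | h) | h
        · exact absurd ⟨_, h.symm⟩ hx
        · exact absurd ⟨_, h.symm⟩ hx
        · exact h
      have hqq : q = q' := by
        by_contra hne
        obtain ⟨-, hxq, -⟩ := hj
        exact Set.disjoint_left.mp (F.inner_disjoint q q' hne) (hinner hxq) (hinner hxq')
      subst hqq
      exact ⟨v, q, hv, hj.tail hadj⟩
  obtain ⟨v, i, hi, hci⟩ := hstart i₀
  have hUall : ∀ x, U x := by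
    intro x
    obtain ⟨w⟩ := hG.preconnected (F.superNode v) x
    have hUv : U (F.superNode v) :=
      ⟨v, (v, v), hΦ_of hi hci, F.joined_refl (F.superNode_fst_mem (v, v))⟩
    have key : ∀ (a b : Fin M) (_ : G.Walk a b), U a → U b := by
      intro a b w
      induction w with
      | nil => exact id
      | cons hadj _ ih => exact fun h => ih (hUstep h hadj)
    exact key _ _ w hUv
  obtain ⟨v', j, hj, hcj⟩ := hstart j₀
  obtain ⟨v'', q, hv'', hjoin⟩ := hUall (F.superNode v')
  rw [← hcj]
  exact hΦstep hv'' hjoin j hj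

end Labels

end FactoredGraph

/-! ## The hybrid model -/

lemma GoodBlock.congr {M N n' : ℕ} {e : Fin N → Sym2 (Fin M)} {i j : Fin N}
    (h : (i : ℕ) / n' = (j : ℕ) / n') (hi : GoodBlock n' e i) : GoodBlock n' e j := by
  unfold GoodBlock at hi ⊢
  rwa [← h]

lemma exists_last_of_block {b n' : ℕ} (i : Fin (b * n')) :
    ∃ j : Fin (b * n'), ((j : ℕ) + 1) % n' = 0 ∧ (j : ℕ) / n' = (i : ℕ) / n' := by
  have hn' : 0 < n' := by
    rcases Nat.eq_zero_or_pos n' with h | h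
    · subst h; exact absurd i.2 (by simp)
    · exact h
  have h1 : (i : ℕ) / n' < b := Nat.div_lt_of_lt_mul (i.2.trans_eq (mul_comm _ _))
  have h2 : ((i : ℕ) / n' + 1) * n' ≤ b * n' := Nat.mul_le_mul_right _ h1
  have h3 : ((i : ℕ) / n' + 1) * n' = (i : ℕ) / n' * n' + n' := by ring
  refine ⟨⟨(i : ℕ) / n' * n' + (n' - 1), by omega⟩, ?_, ?_⟩
  · simp only
    rw [add_assoc, Nat.sub_add_cancel hn', ← h3, Nat.mul_mod_left]
  · simp only
    rw [mul_comm, Nat.mul_add_div hn', Nat.div_eq_of_lt (show n' - 1 < n' by omega), add_zero]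

/-- Rounding up adds at most one, which is at most `log a / log 2`; and `2 / log 2 < 3`. -/
lemma clog_two_le_log {a : ℕ} (ha : 2 ≤ a) : (Nat.clog 2 a : ℝ) ≤ 3 * Real.log a := by
  have hlt : 2 ^ (Nat.clog 2 a - 1) < a := Nat.pow_pred_clog_lt_self (by norm_num) (by omega)
  have hpos : 0 < Nat.clog 2 a := Nat.clog_pos (by norm_num) ha
  have h1 : ((Nat.clog 2 a : ℝ) - 1) * Real.log 2 ≤ Real.log a := by
    have h2 : (2 : ℝ) ^ (Nat.clog 2 a - 1) ≤ a := by exact_mod_cast hlt.le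
    have h3 := Real.log_le_log (by positivity) h2
    rwa [Real.log_pow, Nat.cast_sub hpos, Nat.cast_one] at h3
  have h4 : Real.log 2 ≤ Real.log a := Real.log_le_log (by norm_num) (by exact_mod_cast ha)
  have h5 := Real.log_two_gt_d9
  by_contra! hcon
  nlinarith

/-- The hybrid model for at least two super-nodes. -/
lemma exists_hybridModel (k n n' : ℕ) (hn : 2 ≤ n) (hn' : 1 ≤ n') :
    ∃ T : HybridModel (100 * Nat.clog 2 (n ^ 2 * n')) 2 (2 + (k + 1) * 3)
        (32 * Nat.clog 2 n + 40) 1,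
      T.layers.length = 66 * Nat.clog 2 n + 35 ∧ T.SolvesConnectivity k n n' := by
  set a := Nat.clog 2 n with ha
  set N := n ^ 2 * n' with hN
  set l := Nat.clog 2 N with hl
  have hna : n ≤ 2 ^ a := Nat.le_pow_clog (by norm_num) n
  have hNl : N ≤ 2 ^ l := Nat.le_pow_clog (by norm_num) N
  have ha1 : 0 < a := Nat.clog_pos (by norm_num) hn
  have hn2N : n ^ 2 ≤ N := Nat.le_mul_of_pos_right _ hn'
  have hn4 : 4 ≤ n ^ 2 := by nlinarith
  have hnn : n ≤ n ^ 2 := by nlinarith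
  have hl2 : 2 ≤ l := by
    by_contra! hlt
    have : 2 ^ l ≤ 2 ^ 1 := Nat.pow_le_pow_right (by norm_num) (by omega)
    omega
  have hKt : n ^ 2 ≤ 2 ^ (2 * a) := by
    rw [mul_comm, pow_mul]; exact Nat.pow_le_pow_left hna 2
  -- Since `2 * 15 ^ 11 < 16 ^ 11`, eleven rounds more than halve the number of active labels; `2 *
  -- a + 1` halvings bring `n ^ 2 ≤ 2 ^ (2 * a)` below one.
  have hR : 15 ^ (11 * (2 * a + 1)) * n ^ 2 < 16 ^ (11 * (2 * a + 1)) := by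
    calc 15 ^ (11 * (2 * a + 1)) * n ^ 2 ≤ 15 ^ (11 * (2 * a + 1)) * 2 ^ (2 * a + 1) :=
          Nat.mul_le_mul_left _ (hKt.trans (Nat.pow_le_pow_right (by norm_num) (by omega)))
      _ = (15 ^ 11 * 2) ^ (2 * a + 1) := by rw [pow_mul, mul_pow]
      _ < (16 ^ 11) ^ (2 * a + 1) := Nat.pow_lt_pow_left (by norm_num) (by omega)
      _ = 16 ^ (11 * (2 * a + 1)) := by rw [pow_mul]
  obtain ⟨Ls, hLs, hrun⟩ := exists_connectivity_layers (p := 100 * l) (m := 32 * a + 40)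
    (t := 2 * a) (K := n ^ 2) hl2 rfl (by omega) (by omega) (by omega) hKt (hn2N.trans hNl) hR
  refine ⟨⟨componentRNN _ k n' _, Ls, fun y => decide (Tok.dec y 3 = Tok.dec y 4)⟩, ?_, ?_⟩
  · rw [hLs]; ring
  intro M G e F i _
  have hlp : 2 ^ l * 2 ^ l ≤ 2 ^ (100 * l) := by
    rw [← pow_add]; exact Nat.pow_le_pow_right (by norm_num) (by omega)
  have hM : M ≤ 2 ^ l * 2 ^ l := by
    have h1 := F.card_le
    have h2 : n + 2 * (n ^ 2 * n') ≤ 4 * N := by omega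
    have h3 : 4 * N ≤ 2 ^ l * 2 ^ l :=
      Nat.mul_le_mul (le_trans (by norm_num) (Nat.pow_le_pow_right (n := 2) (by norm_num) hl2)) hNl
    omega
  obtain ⟨x, hx, hxs⟩ := componentRNN_apply (p := 100 * l) (k := k) (n' := n')
    (m := 32 * a + 40) e (hM.trans hlp)
    (hNl.trans (Nat.pow_le_pow_right (by norm_num) (by omega)))
    (fun s t h => F.le_add_of_blockMeet h)
  have hb : ∀ z : ℕ, z ≤ 2 ^ l * 2 ^ l → |(z : ℤ)| ≤ ((2 : ℤ) ^ l) ^ 2 := by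
    intro z hz
    rw [abs_of_nonneg (by positivity), sq]
    exact_mod_cast hz
  have hX1 : 1 ≤ 2 ^ l := Nat.one_le_two_pow
  have hlt : ∀ i : Fin (n ^ 2 * n'), (i : ℕ) / n' < n ^ 2 := fun i =>
    Nat.div_lt_of_lt_mul (i.2.trans_eq (mul_comm _ _))
  have hvalid : Tok.Valid (2 ^ l) x := by
    refine ⟨fun i c => ?_, fun i => (hxs i).2.1⟩
    obtain ⟨⟨h0, h1⟩, h2, h3, h5, h4, -⟩ := hxs i
    fin_cases c
    · exact (congrArg abs h0).trans_le (hb _ ((Fin.is_lt _).le.trans hM))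
    · exact (congrArg abs h1).trans_le (hb _ ((Fin.is_lt _).le.trans hM))
    · exact (congrArg abs h2).trans_le (hb _ (i.2.le.trans (hNl.trans
        (Nat.le_mul_of_pos_right _ hX1))))
    · exact (congrArg abs h3).trans_le (hb _ ((hlt i).le.trans ((hn2N.trans hNl).trans
        (Nat.le_mul_of_pos_right _ hX1))))
    · rcases h4 with h4 | h4
      · exact (congrArg abs h4).trans_le (hb 0 (Nat.zero_le _))
      · exact (congrArg abs h4).trans_le (hb 1 (Nat.mul_pos hX1 hX1))
    · exact (congrArg abs h5).trans_le (hb 0 (Nat.zero_le _))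
  have hlab : ∀ i, 0 ≤ x i 3 ∧ x i 3 < ((n ^ 2 : ℕ) : ℤ) := by
    intro i
    rw [(hxs i).2.2.1]
    exact ⟨by positivity, by exact_mod_cast hlt i⟩
  have hflag : ∀ i, GoodBlock n' e i → ∃ j, x j 4 = 1 ∧ x j 3 = x i 3 := by
    intro i hi
    obtain ⟨j, hj, hji⟩ := exists_last_of_block i
    refine ⟨j, (hxs j).2.2.2.2.2.mpr ⟨hj, hi.congr hji.symm⟩, ?_⟩
    rw [(hxs j).2.2.1, (hxs i).2.2.1, hji]
  have hv₀ : 0 < n := by omega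
  have hex : ∃ i, x i 4 = 1 := by
    obtain ⟨i, hi⟩ := F.exists_blk_eq hn' (⟨0, hv₀⟩, ⟨0, hv₀⟩)
    obtain ⟨j, hj, -⟩ := hflag i (F.goodBlock_of_connected (by rw [hi]; exact Or.inl rfl))
    exact ⟨j, hj⟩
  obtain ⟨x', τ, c, hrun', hx'b, hx'c, hτ, hτ', hc₁, hc₂, hcE⟩ := hrun _ x
    (by exact_mod_cast hNl) hvalid hlab (fun i => (hxs i).2.2.2.2.1) hex
  have hblk : ∀ i j, x i 3 = x j 3 ↔ (i : ℕ) / n' = (j : ℕ) / n' := fun i j => by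
    rw [(hxs i).2.2.1, (hxs j).2.2.1]; exact Nat.cast_inj
  have hmeet : ∀ i j, (x i).res (x j) = 0 ↔ ∃ v, v ∈ e i ∧ v ∈ e j := fun i j => by
    rw [Tok.res_eq_zero, (hxs i).1.1, (hxs i).1.2, (hxs j).1.1, (hxs j).1.2]
    exact edgesMeet_iff _ _
  have hτgood : ∀ i, GoodBlock n' e (τ i) := by
    intro i
    obtain ⟨j, hj, hji⟩ := hτ i
    exact ((hxs j).2.2.2.2.2.mp hj).2.congr ((hblk _ _).mp hji)
  have hτself : ∀ i, GoodBlock n' e i → τ i = i := fun i hi => hτ' i (hflag i hi)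
  have hout : HybridModel.run (⟨componentRNN (100 * l) k n' (32 * a + 40), Ls,
      fun y => decide (Tok.dec y 3 = Tok.dec y 4)⟩ : HybridModel _ _ _ _ 1)
      (fun t => edgeToken (100 * l) (e t)) i = decide (x' i 3 = x' i 4) := by
    have h1 : runLayers Ls ((componentRNN (100 * l) k n' (32 * a + 40)).apply
        fun t => edgeToken (100 * l) (e t)) = fun i => Tok.enc _ _ (x' i) := by rw [hx, hrun']
    have h2 := congrFun h1 i
    simp only [runLayers] at h2
    simp only [HybridModel.run]
    rw [h2, Tok.dec_enc (by omega) (hx'b i)]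
  rw [hout, decide_eq_true_iff, hx'c]
  constructor
  · intro h
    refine F.connected_of_labels hn' ⟨0, hv₀⟩ hτgood hτself (c := c) ?_
      (fun s t => (h s).trans (h t).symm)
    intro E hE hm hs
    exact hcE E hE (fun i j hij => hm i j ((hmeet _ _).mp hij))
      (fun i j hij => hs i j ((hblk _ _).mp hij))
  · intro hG j
    exact F.labels_eq_of_connected hn' hτgood hτself
      (fun i j hij => hc₁ i j ((hmeet _ _).mpr hij))
      (fun i j hij => hc₂ i j ((hblk _ _).mpr hij)) hG i j

theorem mainTheorem9 :
    ∃ C₁ : ℝ, ∀ ε : ℝ, 0 < ε → ε < 1 → ∃ C₂ : ℝ,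
      ∀ k n n' : ℕ, 1 ≤ n → 1 ≤ n' →
        ∃ (p h m H : ℕ) (T : HybridModel p 2 h m H),
          (p : ℝ) ≤ C₂ * Real.log ((n : ℝ) ^ 2 * (n' : ℝ) + 1) ∧
          (h : ℝ) ≤ C₁ * ((k : ℝ) + 1) ∧
          (T.layers.length : ℝ) ≤ C₂ * Real.log (n : ℝ) ∧
          (m : ℝ) ≤ C₂ * (n : ℝ) ^ ε ∧
          (H : ℝ) ≤ C₂ ∧
          T.SolvesConnectivity k n n' := by
  -- The hidden dimension is `2 + 3 * (k + 1) ≤ 5 * (k + 1)`. By `clog_two_le_log`, 300 covers the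
  -- precision `100 * clog` and the depth `66 * clog + 35`; `96 / ε` comes from `32 * clog ≤ 96 *
  -- log n` and `log n ≤ n ^ ε / ε`.
  refine ⟨5, fun ε hε _ => ⟨300 + 96 / ε, fun k n n' hn hn' => ?_⟩⟩
  have hε' : 0 < 96 / ε := by positivity
  rcases Nat.eq_or_lt_of_le hn with rfl | hn2
  -- For `n = 1` the bound `C₂ * log n` allows no layer, but the graph is then a single connected
  -- super-edge graph and the constant answer is right.
  · refine ⟨0, 0, 0, 0, ⟨⟨fun _ => Fixed.clamp 0 0, fun _ h => (h, h)⟩, [], fun _ => true⟩,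
      ?_, ?_, ?_, ?_, ?_, ?_⟩
    · have : 0 ≤ Real.log (((1 : ℕ) : ℝ) ^ 2 * (n' : ℝ) + 1) := by
        apply Real.log_nonneg
        have : (0 : ℝ) ≤ n' := Nat.cast_nonneg _
        push_cast
        linarith
      push_cast at this ⊢
      positivity
    · push_cast; positivity
    · simp
    · push_cast; positivity
    · push_cast; positivity
    · intro M G e F i _
      refine ⟨fun _ => ?_, fun _ => rfl⟩
      refine F.connected_of_superNodes 0 fun v v' => ?_
      rw [Subsingleton.elim v v']
  · obtain ⟨T, hTl, hT⟩ := exists_hybridModel k n n' hn2 hn'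
    refine ⟨_, _, _, _, T, ?_, ?_, ?_, ?_, ?_, hT⟩
    · have hN2 : 2 ≤ n ^ 2 * n' := by nlinarith [Nat.mul_le_mul (Nat.pow_le_pow_left hn2 2) hn']
      have h1 := clog_two_le_log hN2
      have h2 : Real.log ((n ^ 2 * n' : ℕ) : ℝ) ≤ Real.log ((n : ℝ) ^ 2 * (n' : ℝ) + 1) := by
        apply Real.log_le_log
        · have : 0 < n ^ 2 * n' := by omega
          exact_mod_cast this
        · push_cast; linarith
      have h3 : 0 ≤ Real.log ((n ^ 2 * n' : ℕ) : ℝ) := Real.log_natCast_nonneg _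
      rw [Nat.cast_mul, Nat.cast_ofNat]
      nlinarith
    · push_cast
      have : (0 : ℝ) ≤ k := Nat.cast_nonneg _
      linarith
    · have h1 := clog_two_le_log hn2
      have h2 : Real.log 2 ≤ Real.log n := Real.log_le_log (by norm_num) (by exact_mod_cast hn2)
      have h3 := Real.log_two_gt_d9
      rw [hTl]
      push_cast
      nlinarith
    · have h1 := clog_two_le_log hn2
      have h2 := Real.log_le_rpow_div (Nat.cast_nonneg n) hε
      have h3 : 1 ≤ (n : ℝ) ^ ε := Real.one_le_rpow (by exact_mod_cast hn) hε.le
      push_cast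
      calc 32 * (Nat.clog 2 n : ℝ) + 40 ≤ 96 * ((n : ℝ) ^ ε / ε) + 300 * (n : ℝ) ^ ε := by
            linarith
        _ = (300 + 96 / ε) * (n : ℝ) ^ ε := by ring
    · push_cast; linarith
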